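/- Let $n\ge 0$ and $w\in S_n$, written in one-line notation as $w(1)w(2)\cdots w(n)$. Use the following notation. - $\mathrm{inv}(w)$ is the number of inversions of $w$. If $w=uv$ with $\mathrm{inv}(w)=\mathrm{inv}(u)+\mathrm{inv}(v)$, then $u\le_R w$ and $v\le_L w$ (right and left weak order). - $\mathrm{maj}(w)=\sum_{i=1}^n \#\{j\ge i : w(j)>w(j+1)\}$. - $\mathrm{raj}(w)=\sum_{k=1}^n r_k$, where $r_k$ is the number of terms of $w(k)w(k+1)\cdots w(n)$ omitted by a longest increasing subsequence of this word among those containing $w(k)$. - The blobs of $w$ are obtained from the dots $(i,w(i))$ (matrix coordinates) as follows: $B_n$ is the set of dots having no other dot strictly to their southeast; remove these, let $B_{n-1}$ be the set of dots with the same property among the remaining ones, and so on until no dots remain. The set partition $\pi(w)$ of $\{1,\dots,n\}$ has as its blocks the sets of column labels of the nonempty blobs. The fireworks image $\Phi(w)\in S_n$ is the permutation whose one-line notation is obtained by ordering the blocks of $\pi(w)$ by increasing largest element and writing each block in decreasing order. The inverse fireworks image is $\Phi_{\rm inv}(w)=\Phi(w^{-1})^{-1}$. - Let $\overline{\partial}_i(f)=\dfrac{(1-x_{i+1})f-s_i\cdot\big((1-x_{i+1})f\big)}{x_i-x_{i+1}}$,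 where $s_i$ exchanges $x_i$ and $x_{i+1}$. The double Grothendieck polynomials $\mathfrak G_w(\boldsymbol x;\boldsymbol y)\in\mathbb Z[x_1,\dots,x_n;y_1,\dots,y_n]$, $w\in S_n$, are the unique family with $\mathfrak G_{w_0}=\prod_{i+j\le n}(x_i+y_j-x_iy_j)$ for $w_0=n\,(n-1)\cdots 1$, with $\overline{\partial}_i\mathfrak G_w=\mathfrak G_{ws_i}$ if $w(i)>w(i+1)$, and with $\overline{\partial}_i\mathfrak G_w=\mathfrak G_w$ if $w(i)<w(i+1)$. Put $\mathfrak G_w(\boldsymbol x)=\mathfrak G_w(\boldsymbol x;\boldsymbol 0)$. The Castelnuovo–Mumford polynomial $\mathfrak{CM}_w(\boldsymbol x)$ is $(-1)^{\deg\mathfrak G_w(\boldsymbol x)-\mathrm{inv}(w)}$ times the highest-degree homogeneous part of $\mathfrak G_w(\boldsymbol x)$. Then $\mathfrak{CM}_w(\boldsymbol x)\neq 0$ and $$\mathrm{raj}(w)=\max\{\mathrm{maj}(v): v\le_R w\}=\max\{\mathrm{maj}(u^{-1}): u\le_L w\}=\deg\mathfrak{CM}_w(\boldsymbol{x}).$$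 The first maximum is attained at $v=\Phi(w)$ and the second at $u=\Phi_{\rm inv}(w)$; that is, $\Phi(w)\le_R w$ and $\mathrm{maj}(\Phi(w))=\mathrm{raj}(w)$, and $\Phi_{\rm inv}(w)\le_L w$ and $\mathrm{maj}(\Phi_{\rm inv}(w)^{-1})=\mathrm{raj}(w)$. -/

import Mathlib

namespace Rajchgot

/-! ### Permutation statistics

`S_n` is `Equiv.Perm (Fin n)`: positions and values are numbered `0, …, n - 1`, and the one-line
notation of `w` is `w 0, w 1, …, w (n - 1)`.  Products are compositions of maps. -/

section Statistics

variable {n : ℕ}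

/-- For `i : Fin (n - 1)`, the position `i` as an element of `Fin n`. -/
def pos (i : Fin (n - 1)) : Fin n := ⟨i, by omega⟩

/-- For `i : Fin (n - 1)`, the position `i + 1` as an element of `Fin n`. -/
def posSucc (i : Fin (n - 1)) : Fin n := ⟨i + 1, by omega⟩

/-- The simple transposition exchanging two consecutive elements. -/
def simple (i : Fin (n - 1)) : Equiv.Perm (Fin n) := Equiv.swap (pos i) (posSucc i)

/-- The number of inversions (Coxeter length) of a permutation. -/
def inv (w : Equiv.Perm (Fin n)) : ℕ :=
  (Finset.univ.filter fun p : Fin n × Fin n => p.1 < p.2 ∧ w p.2 < w p.1).card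

/-- `u ≤_R w`: there is a length additive factorization `w = u v`. -/
def RightWeakLE (u w : Equiv.Perm (Fin n)) : Prop :=
  ∃ v : Equiv.Perm (Fin n), w = u * v ∧ inv w = inv u + inv v

/-- `v ≤_L w`: there is a length additive factorization `w = u v`. -/
def LeftWeakLE (v w : Equiv.Perm (Fin n)) : Prop :=
  ∃ u : Equiv.Perm (Fin n), w = u * v ∧ inv w = inv u + inv v

/-- The number of descents of `w` at positions `j ≥ i`. -/
def majCode (w : Equiv.Perm (Fin n)) (i : Fin n) : ℕ :=
  (Finset.univ.filter fun j : Fin (n - 1) => i ≤ pos j ∧ w (posSucc j) < w (pos j)).card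

/-- The major index. -/
def maj (w : Equiv.Perm (Fin n)) : ℕ := ∑ i, majCode w i

/-- The greatest length of an increasing subsequence of `w k, w (k + 1), …, w (n - 1)` that
contains `w k`.  A subsequence is given by its set of positions. -/
def lisFrom (w : Equiv.Perm (Fin n)) (k : Fin n) : ℕ :=
  ((Finset.Ici k).powerset.filter fun S =>
    k ∈ S ∧ ∀ a ∈ S, ∀ b ∈ S, a < b → w a < w b).sup Finset.card

/-- The Rajchgot code: the number of terms of `w k, …, w (n - 1)` omitted by a longest increasing
subsequence containing `w k`. -/
def rajCode (w : Equiv.Perm (Fin n)) (k : Fin n) : ℕ := (Finset.Ici k).card - lisFrom w k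

/-- The Rajchgot index. -/
def raj (w : Equiv.Perm (Fin n)) : ℕ := ∑ k, rajCode w k

end Statistics

/-! ### The blob diagram and the fireworks map

The dots of the graph of `w` are the cells `(i, w i)` in matrix coordinates; a dot is
named by its row `i`. -/

section Fireworks

variable {n : ℕ}

/-- The dots of `S` that are maximally southeast in `S`. -/
def southeast (w : Equiv.Perm (Fin n)) (S : Finset (Fin n)) : Finset (Fin n) :=
  S.filter fun i => ∀ j ∈ S, ¬ (i < j ∧ w i < w j)

/-- The dots that are not lassoed after the first `d` lassos have been drawn. -/
def unlassoed (w : Equiv.Perm (Fin n)) : ℕ → Finset (Fin n)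
  | 0 => Finset.univ
  | d + 1 => unlassoed w d \ southeast w (unlassoed w d)

/-- The rows of the dots of the blob that is lassoed after `d` others: `blob w 0, blob w 1, …`
are the blobs `B_n, B_{n-1}, …`. -/
def blob (w : Equiv.Perm (Fin n)) (d : ℕ) : Finset (Fin n) := southeast w (unlassoed w d)

/-- The columns of the dots of a blob. -/
def blobCols (w : Equiv.Perm (Fin n)) (d : ℕ) : Finset (Fin n) :=
  (blob w d).map w.toEmbedding

theorem southeast_nonempty (w : Equiv.Perm (Fin n)) {S : Finset (Fin n)} (hS : S.Nonempty) :
    (southeast w S).Nonempty := by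
  refine ⟨S.max' hS, Finset.mem_filter.2 ⟨S.max'_mem hS, fun j hj h => ?_⟩⟩
  exact absurd (S.le_max' j hj) (not_le.2 h.1)

theorem card_unlassoed (w : Equiv.Perm (Fin n)) (d : ℕ) : (unlassoed w d).card ≤ n - d := by
  induction d with
  | zero => simpa using Finset.card_le_univ (unlassoed w 0)
  | succ d ih =>
    rcases (unlassoed w d).eq_empty_or_nonempty with h | h
    · simp [unlassoed, h]
    · have h1 := Finset.card_sdiff_add_card_inter (unlassoed w d) (southeast w (unlassoed w d))
      have h2 : unlassoed w d ∩ southeast w (unlassoed w d) = southeast w (unlassoed w d) :=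
        Finset.inter_eq_right.2 (Finset.filter_subset _ _)
      have h3 := (southeast_nonempty w h).card_pos
      rw [h2] at h1
      simp only [unlassoed]
      omega

theorem unlassoed_anti (w : Equiv.Perm (Fin n)) : Antitone (unlassoed w) :=
  antitone_nat_of_succ_le fun _ => Finset.sdiff_subset

theorem blob_disjoint (w : Equiv.Perm (Fin n)) {d e : ℕ} (h : d < e) :
    Disjoint (blob w d) (blob w e) := by
  rw [Finset.disjoint_left]
  intro i hi hi'
  have h1 : i ∈ unlassoed w (d + 1) := unlassoed_anti w h (Finset.mem_of_mem_filter i hi')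
  exact (Finset.mem_sdiff.1 h1).2 hi

theorem exists_mem_blob (w : Equiv.Perm (Fin n)) (i : Fin n) : ∃ d < n, i ∈ blob w d := by
  by_contra! h
  have key : ∀ d ≤ n, i ∈ unlassoed w d := by
    intro d
    induction d with
    | zero => intro _; simp [unlassoed]
    | succ d ih => intro hd; exact Finset.mem_sdiff.2 ⟨ih (by omega), h d (by omega)⟩
  have h1 := card_unlassoed w n
  have h2 := Finset.card_pos.2 ⟨i, key n le_rfl⟩
  omega

theorem blobCols_disjoint (w : Equiv.Perm (Fin n)) {d e : ℕ} (h : d ≠ e) :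
    Disjoint (blobCols w d) (blobCols w e) := by
  rw [blobCols, blobCols, Finset.disjoint_map]
  rcases h.lt_or_gt with h | h
  · exact blob_disjoint w h
  · exact (blob_disjoint w h).symm

/-- The set partition of `w`: its blocks are the sets of columns of the (nonempty) blobs. -/
def setPartition (w : Equiv.Perm (Fin n)) : Finpartition (Finset.univ : Finset (Fin n)) :=
  Finpartition.ofErase ((Finset.range n).image (blobCols w))
    (by
      rw [Finset.supIndep_iff_pairwiseDisjoint]
      intro A hA B hB hAB
      obtain ⟨d, -, rfl⟩ := Finset.mem_image.1 hA
      obtain ⟨e, -, rfl⟩ := Finset.mem_image.1 hB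
      exact blobCols_disjoint w fun h => hAB (by rw [h]))
    (by
      refine Finset.eq_univ_of_forall fun c => ?_
      obtain ⟨d, hd, hm⟩ := exists_mem_blob w (w.symm c)
      rw [Finset.mem_sup]
      exact ⟨blobCols w d, Finset.mem_image_of_mem _ (Finset.mem_range.2 hd),
        Finset.mem_map.2 ⟨_, hm, by simp⟩⟩)

/-- The word obtained from a set partition by ordering its blocks increasingly by their largest
elements and writing each block backwards (in decreasing order): the letters `c` that are the
largest of their block are listed in increasing order, and each is replaced by its block. -/
def partitionWord (P : Finpartition (Finset.univ : Finset (Fin n))) : List (Fin n) :=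
  ((List.finRange n).filter fun c => ∀ b ∈ P.part c, b ≤ c).flatMap
    fun c => (P.part c).sort (· ≥ ·)

theorem partitionWord_nodup (P : Finpartition (Finset.univ : Finset (Fin n))) :
    (partitionWord P).Nodup := by
  rw [partitionWord, List.nodup_flatMap]
  refine ⟨fun c _ => Finset.sort_nodup _ _, ?_⟩
  have h1 := (List.nodup_finRange n).filter (fun c => decide (∀ b ∈ P.part c, b ≤ c))
  refine List.Pairwise.imp_of_mem ?_ h1
  intro c d hc hd hcd a hac had
  simp only [Finset.mem_sort] at hac had
  have hc' : ∀ b ∈ P.part c, b ≤ c := by simpa using (List.mem_filter.1 hc).2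
  have hd' : ∀ b ∈ P.part d, b ≤ d := by simpa using (List.mem_filter.1 hd).2
  have e : P.part c = P.part d := by
    rw [← P.part_eq_of_mem (P.part_mem.2 (Finset.mem_univ c)) hac,
      ← P.part_eq_of_mem (P.part_mem.2 (Finset.mem_univ d)) had]
  have hcc : c ∈ P.part d := e ▸ P.mem_part (Finset.mem_univ c)
  have hdd : d ∈ P.part c := e ▸ P.mem_part (Finset.mem_univ d)
  exact hcd (le_antisymm (hd' c hcc) (hc' d hdd))

theorem mem_partitionWord (P : Finpartition (Finset.univ : Finset (Fin n))) (a : Fin n) :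
    a ∈ partitionWord P := by
  have ha : a ∈ P.part a := P.mem_part (Finset.mem_univ a)
  have hmem := (P.part a).max'_mem ⟨a, ha⟩
  have e : P.part ((P.part a).max' ⟨a, ha⟩) = P.part a :=
    P.part_eq_of_mem (P.part_mem.2 (Finset.mem_univ a)) hmem
  refine List.mem_flatMap.2 ⟨(P.part a).max' ⟨a, ha⟩, List.mem_filter.2 ⟨List.mem_finRange _, ?_⟩, ?_⟩
  · simp only [e, decide_eq_true_eq]
    exact fun b hb => Finset.le_max' _ b hb
  · simpa only [e, Finset.mem_sort] using ha

theorem partitionWord_length (P : Finpartition (Finset.univ : Finset (Fin n))) :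
    n = (partitionWord P).length := by
  have h := Fintype.card_congr
    ((partitionWord_nodup P).getEquivOfForallMemList _ (mem_partitionWord P))
  simpa using h.symm

/-- The permutation whose one-line notation is `partitionWord P`. -/
def ofPartition (P : Finpartition (Finset.univ : Finset (Fin n))) : Equiv.Perm (Fin n) :=
  (finCongr (partitionWord_length P)).trans
    ((partitionWord_nodup P).getEquivOfForallMemList _ (mem_partitionWord P))

/-- The fireworks map `Φ`. -/
def fireworks (w : Equiv.Perm (Fin n)) : Equiv.Perm (Fin n) := ofPartition (setPartition w)

/-- The inverse fireworks map `Φ_inv`. -/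
def invFireworks (w : Equiv.Perm (Fin n)) : Equiv.Perm (Fin n) := (fireworks w⁻¹)⁻¹

end Fireworks

/-! ### Grothendieck polynomials -/

section Grothendieck

open MvPolynomial

section Operators

variable {n : ℕ} {R : Type*} [CommRing R]

theorem simple_pos (i : Fin (n - 1)) : simple i (pos i) = posSucc i := Equiv.swap_apply_left _ _

theorem simple_posSucc (i : Fin (n - 1)) : simple i (posSucc i) = pos i :=
  Equiv.swap_apply_right _ _

theorem simple_of_ne {i : Fin (n - 1)} {k : Fin n} (h1 : k ≠ pos i) (h2 : k ≠ posSucc i) :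
    simple i k = k := Equiv.swap_apply_of_ne_of_ne h1 h2

theorem pos_ne_posSucc (i : Fin (n - 1)) : pos i ≠ posSucc i := by
  simp [pos, posSucc, Fin.ext_iff]

theorem dvd_sub_rename (i : Fin (n - 1)) (f : MvPolynomial (Fin n) R) :
    (X (pos i) - X (posSucc i) : MvPolynomial (Fin n) R) ∣ f - rename (simple i) f := by
  induction f using MvPolynomial.induction_on with
  | C a => simp
  | add p q hp hq =>
    rw [map_add, add_sub_add_comm]
    exact dvd_add hp hq
  | mul_X p k hp =>
    have e : p * X k - rename (simple i) (p * X k) =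
        (p - rename (simple i) p) * X k + rename (simple i) p * (X k - X (simple i k)) := by
      rw [map_mul, rename_X]; ring
    rw [e]
    refine dvd_add (hp.mul_right _) (Dvd.dvd.mul_left ?_ _)
    by_cases h1 : k = pos i
    · rw [h1, simple_pos]
    · by_cases h2 : k = posSucc i
      · rw [h2, simple_posSucc, ← dvd_neg, neg_sub]
      · rw [simple_of_ne h1 h2, sub_self]; exact dvd_zero _

/-- The divided difference operator `f ↦ (f - s_i · f) / (x_i - x_{i+1})`, where `s_i` exchanges
the variables `x_i` and `x_{i+1}`. -/
noncomputable def dividedDiff (i : Fin (n - 1)) (f : MvPolynomial (Fin n) R) :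
    MvPolynomial (Fin n) R :=
  (dvd_sub_rename i f).choose

theorem mul_dividedDiff (i : Fin (n - 1)) (f : MvPolynomial (Fin n) R) :
    (X (pos i) - X (posSucc i)) * dividedDiff i f = f - rename (simple i) f :=
  (dvd_sub_rename i f).choose_spec.symm

/-- The operator `f ↦ ∂_i ((1 - x_{i+1}) f)`. -/
noncomputable def dividedDiffBar (i : Fin (n - 1)) (f : MvPolynomial (Fin n) R) :
    MvPolynomial (Fin n) R :=
  dividedDiff i ((1 - X (posSucc i)) * f)

theorem mul_dividedDiffBar (i : Fin (n - 1)) (f : MvPolynomial (Fin n) R) :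
    (X (pos i) - X (posSucc i)) * dividedDiffBar i f =
      (1 - X (posSucc i)) * f - (1 - X (pos i)) * rename (simple i) f := by
  rw [dividedDiffBar, mul_dividedDiff, map_mul, map_sub, map_one, rename_X, simple_posSucc]

theorem rename_mul_dividedDiffBar (s : Equiv.Perm (Fin n)) (i : Fin (n - 1))
    (f : MvPolynomial (Fin n) R) :
    (X (s (pos i)) - X (s (posSucc i))) * rename s (dividedDiffBar i f) =
      (1 - X (s (posSucc i))) * rename s f -
        (1 - X (s (pos i))) * rename s (rename (simple i) f) := by
  have h := congrArg (rename s) (mul_dividedDiffBar i f)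
  simpa only [map_mul, map_sub, map_one, rename_X] using h

theorem rename_rename_perm (s t : Equiv.Perm (Fin n)) (f : MvPolynomial (Fin n) R) :
    rename s (rename t f) = rename (s * t) f := by
  rw [rename_rename, Equiv.Perm.coe_mul]

theorem simple_mul_self (i : Fin (n - 1)) : simple i * simple i = 1 := Equiv.swap_mul_self _ _

theorem simple_comm {i j : Fin (n - 1)} (h : (i : ℕ) + 1 < j) :
    simple i * simple j = simple j * simple i := by
  refine (Equiv.Perm.disjoint_swap_swap ?_).commute
  simp [pos, posSucc, Fin.ext_iff]
  omega

theorem posSucc_eq_pos {i j : Fin (n - 1)} (h : (i : ℕ) + 1 = j) : posSucc i = pos j := by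
  simp [pos, posSucc, h]

theorem pos_ne_posSucc_next {i j : Fin (n - 1)} (h : (i : ℕ) + 1 = j) : pos i ≠ posSucc j := by
  simp [pos, posSucc, Fin.ext_iff]; omega

theorem simple_braid {i j : Fin (n - 1)} (h : (i : ℕ) + 1 = j) :
    simple i * simple j * simple i = simple j * simple i * simple j := by
  have h1 := pos_ne_posSucc i
  have h2 := pos_ne_posSucc j
  have h3 := pos_ne_posSucc_next h
  rw [posSucc_eq_pos h] at h1
  simp only [simple, posSucc_eq_pos h]
  rw [Equiv.swap_mul_swap_mul_swap h1 h3, Equiv.swap_comm (pos i) (pos j),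
    Equiv.swap_comm (pos j) (posSucc j), Equiv.swap_mul_swap_mul_swap h2.symm h3.symm,
    Equiv.swap_comm]

variable [IsDomain R]

theorem X_sub_X_ne_zero {a b : Fin n} (h : a ≠ b) : (X a - X b : MvPolynomial (Fin n) R) ≠ 0 :=
  sub_ne_zero.2 fun e => h (X_injective e)

theorem dividedDiffBar_idem (i : Fin (n - 1)) (f : MvPolynomial (Fin n) R) :
    dividedDiffBar i (dividedDiffBar i f) = dividedDiffBar i f := by
  have hne := X_sub_X_ne_zero (R := R) (pos_ne_posSucc i)
  have h1 := mul_dividedDiffBar i f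
  have h2 := rename_mul_dividedDiffBar (simple i) i f
  have h3 := mul_dividedDiffBar i (dividedDiffBar i f)
  rw [simple_pos, simple_posSucc, rename_rename_perm, simple_mul_self, Equiv.Perm.coe_one,
    rename_id, AlgHom.id_apply] at h2
  have h4 : rename (simple i) (dividedDiffBar i f) = dividedDiffBar i f := by
    apply mul_left_cancel₀ hne
    linear_combination -h1 - h2
  apply mul_left_cancel₀ hne
  rw [h3, h4]
  ring

theorem dividedDiffBar_comm {i j : Fin (n - 1)} (h : (i : ℕ) + 1 < j)
    (f : MvPolynomial (Fin n) R) :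
    dividedDiffBar i (dividedDiffBar j f) = dividedDiffBar j (dividedDiffBar i f) := by
  have n1 : pos i ≠ pos j := by simp [pos, Fin.ext_iff]; omega
  have n2 : pos i ≠ posSucc j := by simp [pos, posSucc, Fin.ext_iff]; omega
  have n3 : posSucc i ≠ pos j := by simp [pos, posSucc, Fin.ext_iff]; omega
  have n4 : posSucc i ≠ posSucc j := by simp [posSucc, Fin.ext_iff]; omega
  have hi := X_sub_X_ne_zero (R := R) (pos_ne_posSucc i)
  have hj := X_sub_X_ne_zero (R := R) (pos_ne_posSucc j)
  have a1 := mul_dividedDiffBar i f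
  have a2 := rename_mul_dividedDiffBar (simple j) i f
  have a3 := mul_dividedDiffBar j (dividedDiffBar i f)
  have b1 := mul_dividedDiffBar j f
  have b2 := rename_mul_dividedDiffBar (simple i) j f
  have b3 := mul_dividedDiffBar i (dividedDiffBar j f)
  rw [simple_of_ne n1 n2, simple_of_ne n3 n4, rename_rename_perm, ← simple_comm h] at a2
  rw [simple_of_ne n1.symm n3.symm, simple_of_ne n2.symm n4.symm, rename_rename_perm] at b2
  apply mul_left_cancel₀ (mul_ne_zero hi hj)
  generalize rename (simple i * simple j) f = t at *
  linear_combination (X (pos j) - X (posSucc j)) * b3 - (X (pos i) - X (posSucc i)) * a3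
    + (1 - X (posSucc i)) * b1 - (1 - X (pos i)) * b2
    - (1 - X (posSucc j)) * a1 + (1 - X (pos j)) * a2

theorem dividedDiffBar_braid {i j : Fin (n - 1)} (h : (i : ℕ) + 1 = j)
    (f : MvPolynomial (Fin n) R) :
    dividedDiffBar i (dividedDiffBar j (dividedDiffBar i f)) =
      dividedDiffBar j (dividedDiffBar i (dividedDiffBar j f)) := by
  have e := posSucc_eq_pos h
  have n1 : pos i ≠ pos j := e ▸ pos_ne_posSucc i
  have n2 : pos j ≠ posSucc j := pos_ne_posSucc j
  have n3 : pos i ≠ posSucc j := pos_ne_posSucc_next h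
  have hab := X_sub_X_ne_zero (R := R) n1
  have hbc := X_sub_X_ne_zero (R := R) n2
  have hac := X_sub_X_ne_zero (R := R) n3
  have ia : simple i (pos i) = pos j := e ▸ simple_pos i
  have ib : simple i (pos j) = pos i := by rw [← e]; exact simple_posSucc i
  have ic : simple i (posSucc j) = posSucc j := simple_of_ne n3.symm (by rw [e]; exact n2.symm)
  have ja : simple j (pos i) = pos i := simple_of_ne n1 n3
  have jb : simple j (pos j) = posSucc j := simple_pos j
  have jc : simple j (posSucc j) = pos j := simple_posSucc j
  have hb := simple_braid h
  rw [mul_assoc, mul_assoc] at hb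
  have key : ∀ (k : Fin (n - 1)) (s : Equiv.Perm (Fin n)) (g : MvPolynomial (Fin n) R),
      (X (s (pos k)) - X (s (posSucc k))) * rename s (dividedDiffBar k g) =
      (1 - X (s (posSucc k))) * rename s g - (1 - X (s (pos k))) * rename (s * simple k) g := by
    intro k s g
    rw [rename_mul_dividedDiffBar, rename_rename_perm]
  -- the two sides, multiplied by their denominators
  have p0 := mul_dividedDiffBar i f
  have p1 := key i (simple j) f
  have p2 := key i (simple i) f
  have p3 := key i (simple i * simple j) f
  have q0 := mul_dividedDiffBar j (dividedDiffBar i f)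
  have q1 := key j (simple i) (dividedDiffBar i f)
  have r0 := mul_dividedDiffBar i (dividedDiffBar j (dividedDiffBar i f))
  have p0' := mul_dividedDiffBar j f
  have p1' := key j (simple i) f
  have p2' := key j (simple j) f
  have p3' := key j (simple j * simple i) f
  have q0' := mul_dividedDiffBar i (dividedDiffBar j f)
  have q1' := key i (simple j) (dividedDiffBar j f)
  have r0' := mul_dividedDiffBar j (dividedDiffBar i (dividedDiffBar j f))
  simp only [e, Equiv.Perm.mul_apply, ia, ib, ic, ja, jb, mul_assoc, simple_mul_self,
    Equiv.Perm.coe_one, rename_id, AlgHom.id_apply] at p0 p1 p2 p3 q0 q1 r0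
  simp only [e, Equiv.Perm.mul_apply, ib, ic, ja, jb, jc, mul_assoc, simple_mul_self,
    Equiv.Perm.coe_one, rename_id, AlgHom.id_apply] at p0' p1' p2' p3' q0' q1' r0'
  rw [hb] at p3
  apply mul_left_cancel₀ (mul_ne_zero (mul_ne_zero hab hbc) (mul_ne_zero (mul_ne_zero hab hbc) hac))
  generalize (X (pos i) : MvPolynomial (Fin n) R) = A at *
  generalize (X (pos j) : MvPolynomial (Fin n) R) = B at *
  generalize (X (posSucc j) : MvPolynomial (Fin n) R) = C at *
  linear_combination (B - C) * ((A - B) * (B - C) * (A - C) * r0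
      + (1 - B) * (A - B) * (A - C) * q0 - (1 - A) * (A - B) * (B - C) * q1
      + (1 - B) * (1 - C) * (A - C) * p0 - (1 - B) ^ 2 * (A - B) * p1
      + (1 - A) * (1 - C) * (B - C) * p2 + (1 - A) ^ 2 * (A - B) * p3)
    - (A - B) * ((A - B) * (B - C) * (A - C) * r0'
      + (1 - C) * (B - C) * (A - C) * q0' - (1 - B) * (A - B) * (B - C) * q1'
      + (1 - C) * (1 - B) * (A - C) * p0' - (1 - C) * (1 - A) * (B - C) * p1'
      + (1 - B) * (1 - C) * (A - B) * p2' + (1 - B) * (1 - A) * (B - C) * p3')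

end Operators

section Families

variable {n : ℕ} {A : Type*}

/-- `F` starts at `a` for the longest element `w₀` and satisfies the recursion
`D i (F w) = F (w s_i)` if `i` is a descent of `w` (that is, `w s_i <_R w`) and
`D i (F w) = F w` otherwise. -/
structure IsRecursiveFamily (D : Fin (n - 1) → A → A) (a : A) (F : Equiv.Perm (Fin n) → A) :
    Prop where
  initial : F Fin.revPerm = a
  descent : ∀ (w : Equiv.Perm (Fin n)) (i : Fin (n - 1)),
    w (posSucc i) < w (pos i) → D i (F w) = F (w * simple i)
  ascent : ∀ (w : Equiv.Perm (Fin n)) (i : Fin (n - 1)),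
    w (pos i) < w (posSucc i) → D i (F w) = F w

/-- An auxiliary weight that decreases along ascents. -/
def weight (w : Equiv.Perm (Fin n)) : ℕ := ∑ k : Fin n, (k : ℕ) * (w k : ℕ)

theorem weight_lt (w : Equiv.Perm (Fin n)) (i : Fin (n - 1)) (h : w (pos i) < w (posSucc i)) :
    weight (w * simple i) < weight w := by
  have e1 : weight (w * simple i) = ∑ k : Fin n, (simple i k : ℕ) * (w k : ℕ) := by
    rw [weight, ← Equiv.sum_comp (simple i)]
    refine Finset.sum_congr rfl fun k _ => ?_
    rw [Equiv.Perm.mul_apply, ← Equiv.Perm.mul_apply (simple i) (simple i), simple_mul_self,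
      Equiv.Perm.one_apply]
  have e2 : (weight w : ℤ) - weight (w * simple i) =
      ∑ k : Fin n, ((k : ℕ) - (simple i k : ℕ) : ℤ) * (w k : ℕ) := by
    rw [e1, weight]
    push_cast
    rw [← Finset.sum_sub_distrib]
    exact Finset.sum_congr rfl fun k _ => by ring
  rw [Fintype.sum_eq_add (pos i) (posSucc i) (pos_ne_posSucc i)
    (fun k hk => by rw [simple_of_ne hk.1 hk.2]; ring), simple_pos, simple_posSucc] at e2
  have h1 : ((pos i : Fin n) : ℕ) = i := rfl
  have h2 : ((posSucc i : Fin n) : ℕ) = i + 1 := rfl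
  rw [h1, h2] at e2
  push_cast at e2
  have h3 : ((w (pos i) : ℕ) : ℤ) < (w (posSucc i) : ℕ) := by exact_mod_cast h
  have : (weight (w * simple i) : ℤ) < weight w := by linarith
  exact_mod_cast this

theorem mul_simple_simple (w : Equiv.Perm (Fin n)) (i : Fin (n - 1)) :
    w * simple i * simple i = w := by
  rw [mul_assoc, simple_mul_self, mul_one]

theorem eq_rev_of_no_ascent (w : Equiv.Perm (Fin n))
    (h : ∀ i : Fin (n - 1), ¬ w (pos i) < w (posSucc i)) : w = Fin.revPerm := by
  match n, w, h with
  | 0, w, _ => exact Subsingleton.elim _ _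
  | m + 1, w, h =>
    have h1 : StrictAnti w := by
      refine Fin.strictAnti_iff_succ_lt.2 fun i => ?_
      refine lt_of_le_of_ne (not_lt.1 (h i)) fun e => ?_
      exact pos_ne_posSucc (n := m + 1) i (w.injective e).symm
    have h2 : StrictMono (w * Fin.revPerm : Equiv.Perm (Fin (m + 1))) := fun a b hab => by
      simpa [Equiv.Perm.mul_apply] using h1 (Fin.rev_lt_rev.2 hab)
    have h3 : (w * Fin.revPerm) = 1 := by
      have := Subsingleton.elim
        ((StrictMono.orderIsoOfSurjective _ h2 (Equiv.surjective _))) (OrderIso.refl (Fin (m + 1)))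
      ext k
      exact congrArg Fin.val (DFunLike.congr_fun this k)
    have h4 : (Fin.revPerm : Equiv.Perm (Fin (m + 1))) * Fin.revPerm = 1 := by
      ext k; simp
    rw [← mul_one w, ← h4, ← mul_assoc, h3, one_mul]

open Classical in
/-- The family built from `a` along the first ascents. -/
noncomputable def recFamily (D : Fin (n - 1) → A → A) (a : A) (w : Equiv.Perm (Fin n)) : A :=
  if h : ∃ i : Fin (n - 1), w (pos i) < w (posSucc i) then
    D h.choose (recFamily D a (w * simple h.choose))
  else a
termination_by weight w
decreasing_by exact weight_lt w _ h.choose_spec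

theorem recFamily_step {D : Fin (n - 1) → A → A} (a : A)
    (hcomm : ∀ i j : Fin (n - 1), (i : ℕ) + 1 < j → ∀ x, D i (D j x) = D j (D i x))
    (hbraid : ∀ i j : Fin (n - 1), (i : ℕ) + 1 = j →
      ∀ x, D i (D j (D i x)) = D j (D i (D j x)))
    (w : Equiv.Perm (Fin n)) (j : Fin (n - 1)) (hj : w (pos j) < w (posSucc j)) :
    recFamily D a w = D j (recFamily D a (w * simple j)) := by
  induction hN : weight w using Nat.strong_induction_on generalizing w j with
  | _ N ih =>
  have IH : ∀ u : Equiv.Perm (Fin n), weight u < weight w → ∀ k : Fin (n - 1),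
      u (pos k) < u (posSucc k) → recFamily D a u = D k (recFamily D a (u * simple k)) :=
    fun u hu k hk => ih _ (hN ▸ hu) u k hk rfl
  -- any two ascents give the same element
  have key : ∀ i k : Fin (n - 1), i < k → w (pos i) < w (posSucc i) →
      w (pos k) < w (posSucc k) →
      D i (recFamily D a (w * simple i)) = D k (recFamily D a (w * simple k)) := by
    intro i k hik hi hk
    have li := weight_lt w i hi
    have lk := weight_lt w k hk
    rcases Nat.lt_or_ge ((i : ℕ) + 1) k with h | h
    · have n1 : pos i ≠ pos k := by simp [pos, Fin.ext_iff]; omega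
      have n2 : pos i ≠ posSucc k := by simp [pos, posSucc, Fin.ext_iff]; omega
      have n3 : posSucc i ≠ pos k := by simp [pos, posSucc, Fin.ext_iff]; omega
      have n4 : posSucc i ≠ posSucc k := by simp [posSucc, Fin.ext_iff]; omega
      rw [IH _ li k (by
          rwa [Equiv.Perm.mul_apply, Equiv.Perm.mul_apply, simple_of_ne n1.symm n3.symm,
            simple_of_ne n2.symm n4.symm]),
        IH _ lk i (by
          rwa [Equiv.Perm.mul_apply, Equiv.Perm.mul_apply, simple_of_ne n1 n2,
            simple_of_ne n3 n4]),
        hcomm i k h, mul_assoc, mul_assoc, simple_comm h]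
    · have h' : (i : ℕ) + 1 = k := le_antisymm hik h
      have e := posSucc_eq_pos h'
      have n1 : pos i ≠ pos k := e ▸ pos_ne_posSucc i
      have n2 : pos k ≠ posSucc k := pos_ne_posSucc k
      have n3 : pos i ≠ posSucc k := pos_ne_posSucc_next h'
      have ia : simple i (pos i) = pos k := e ▸ simple_pos i
      have ib : simple i (pos k) = pos i := by rw [← e]; exact simple_posSucc i
      have ic : simple i (posSucc k) = posSucc k :=
        simple_of_ne n3.symm (by rw [e]; exact n2.symm)
      have ja : simple k (pos i) = pos i := simple_of_ne n1 n3
      have jb : simple k (pos k) = posSucc k := simple_pos k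
      have jc : simple k (posSucc k) = pos k := simple_posSucc k
      rw [e] at hi
      have u1 : (w * simple i) (pos k) < (w * simple i) (posSucc k) := by
        rw [Equiv.Perm.mul_apply, Equiv.Perm.mul_apply, ib, ic]; exact hi.trans hk
      have u2 : (w * simple i * simple k) (pos i) < (w * simple i * simple k) (posSucc i) := by
        simp only [Equiv.Perm.mul_apply, e, ja, jb, ia, ic]; exact hk
      have v1 : (w * simple k) (pos i) < (w * simple k) (posSucc i) := by
        rw [Equiv.Perm.mul_apply, Equiv.Perm.mul_apply, e, ja, jb]; exact hi.trans hk
      have v2 : (w * simple k * simple i) (pos k) < (w * simple k * simple i) (posSucc k) := by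
        simp only [Equiv.Perm.mul_apply, ib, ic, ja, jc]; exact hi
      have l1 := (weight_lt _ _ u1).trans li
      have l2 := (weight_lt _ _ v1).trans lk
      rw [IH _ li k u1, IH _ l1 i u2, IH _ lk i v1, IH _ l2 k v2, hbraid i k h']
      have hb := simple_braid h'
      have : w * simple i * simple k * simple i = w * simple k * simple i * simple k := by
        simp only [mul_assoc] at hb ⊢
        rw [hb]
      rw [this]
  have hex : ∃ i : Fin (n - 1), w (pos i) < w (posSucc i) := ⟨j, hj⟩
  rw [recFamily, dif_pos hex]
  rcases lt_trichotomy hex.choose j with h | h | h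
  · exact key _ _ h hex.choose_spec hj
  · rw [h]
  · exact (key _ _ h hj hex.choose_spec).symm

theorem existsUnique_isRecursiveFamily {D : Fin (n - 1) → A → A} (a : A)
    (hidem : ∀ i x, D i (D i x) = D i x)
    (hcomm : ∀ i j : Fin (n - 1), (i : ℕ) + 1 < j → ∀ x, D i (D j x) = D j (D i x))
    (hbraid : ∀ i j : Fin (n - 1), (i : ℕ) + 1 = j →
      ∀ x, D i (D j (D i x)) = D j (D i (D j x))) :
    ∃! F : Equiv.Perm (Fin n) → A, IsRecursiveFamily D a F := by
  have step := recFamily_step (D := D) a hcomm hbraid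
  refine ⟨recFamily D a, ⟨?_, ?_, ?_⟩, ?_⟩
  · rw [recFamily, dif_neg]
    rintro ⟨i, hi⟩
    have h1 : pos i < posSucc i := Nat.lt_succ_self (i : ℕ)
    exact lt_asymm h1 (Fin.rev_lt_rev.1 hi)
  · intro w i hi
    have := step (w * simple i) i (by
      rwa [Equiv.Perm.mul_apply, Equiv.Perm.mul_apply, simple_pos, simple_posSucc])
    rw [this, mul_simple_simple]
  · intro w i hi
    rw [step w i hi, hidem]
  · intro F hF
    funext w
    induction hN : weight w using Nat.strong_induction_on generalizing w with
    | _ N ih =>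
    by_cases hex : ∃ i : Fin (n - 1), w (pos i) < w (posSucc i)
    · obtain ⟨i, hi⟩ := hex
      have h1 := hF.descent (w * simple i) i (by
        rwa [Equiv.Perm.mul_apply, Equiv.Perm.mul_apply, simple_pos, simple_posSucc])
      rw [mul_simple_simple] at h1
      rw [← h1, step w i hi, ih _ (hN ▸ weight_lt w i hi) _ rfl]
    · have hw := eq_rev_of_no_ascent w (by simpa using hex)
      rw [recFamily, dif_neg hex, hw, hF.initial]

end Families

variable {n : ℕ}

/-- The double Grothendieck polynomial of `w₀`: the product of `x_i + y_j - x_i y_j` over all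
`1 ≤ i, j ≤ n` with `i + j ≤ n`.  Double polynomials are polynomials in `x` whose coefficients are
polynomials in `y`. -/
noncomputable def doubleGrothendieckTop (n : ℕ) :
    MvPolynomial (Fin n) (MvPolynomial (Fin n) ℤ) :=
  ∏ p ∈ Finset.univ.filter (fun p : Fin n × Fin n => ((p.1 : ℕ) + 1) + ((p.2 : ℕ) + 1) ≤ n),
    (X p.1 + C (X p.2) - X p.1 * C (X p.2))

/-- There is exactly one family of polynomials with the defining recursion of the double
Grothendieck polynomials. -/
theorem existsUnique_doubleGrothendieck (n : ℕ) :
    ∃! G : Equiv.Perm (Fin n) → MvPolynomial (Fin n) (MvPolynomial (Fin n) ℤ),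
      IsRecursiveFamily dividedDiffBar (doubleGrothendieckTop n) G :=
  existsUnique_isRecursiveFamily _ dividedDiffBar_idem (fun _ _ h => dividedDiffBar_comm h)
    (fun _ _ h => dividedDiffBar_braid h)

/-- The double Grothendieck polynomials `𝔊_w(x; y)`. -/
noncomputable def doubleGrothendieck (w : Equiv.Perm (Fin n)) :
    MvPolynomial (Fin n) (MvPolynomial (Fin n) ℤ) :=
  (existsUnique_doubleGrothendieck n).choose w

theorem isRecursiveFamily_doubleGrothendieck (n : ℕ) :
    IsRecursiveFamily dividedDiffBar (doubleGrothendieckTop n) (doubleGrothendieck (n := n)) :=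
  (existsUnique_doubleGrothendieck n).choose_spec.1

/-- The Grothendieck polynomial `𝔊_w(x) = 𝔊_w(x; 0)`. -/
noncomputable def grothendieck (w : Equiv.Perm (Fin n)) : MvPolynomial (Fin n) ℤ :=
  map (eval fun _ => (0 : ℤ)) (doubleGrothendieck w)

/-- The Castelnuovo–Mumford polynomial: `(-1) ^ (deg 𝔊_w - inv w)` times the highest-degree
homogeneous part of `𝔊_w(x)`. -/
noncomputable def castelnuovoMumford (w : Equiv.Perm (Fin n)) : MvPolynomial (Fin n) ℤ :=
  C ((((-1 : ℤˣ) ^ (((grothendieck w).totalDegree : ℤ) - inv w) : ℤˣ) : ℤ)) *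
    homogeneousComponent (grothendieck w).totalDegree (grothendieck w)

end Grothendieck

end Rajchgot

/-!
Write `lisFrom w k` for the length of a longest increasing subsequence of `w` starting at position
`k`.  It is the least positive function of the dots of `w` that strictly decreases towards the
southeast (`lisFrom_lt`, `lisFrom_le`), and `raj w + ∑ k, lisFrom w k` depends on `n` only
(`raj_add`).  Hence `raj w⁻¹ = raj w`, and `raj` is monotone for the right weak order, which is
containment of the sets of inverted pairs of values (`rightWeakLE_iff`, `raj_mono`).

*Major indices.*  Counting ascents gives `maj v ≤ raj v` (`maj_le_raj`), so `raj w` bounds `maj v`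
for all `v ≤_R w`.  The blobs are the level sets of `lisFrom`; along the word of `fireworks w` the
levels decrease weakly, and within a level the values decrease (`fireworks_label`).  This gives both
`fireworks w ≤_R w` and `raj w ≤ maj (fireworks w)`.  The statements about the left weak order follow
by inversion.

*Pipe dreams.*  In the 0-Hecke algebra with generators `T_i`, `T_i ^ 2 = -T_i`, consider the product
over `k = 1, …, n - 1` of the rows `(1 + x_k T_{n-1}) ⋯ (1 + x_k T_k)`.  The Yang–Baxter equation
(`IsZeroHecke.yangBaxter`) shows how the product changes when `x_i` and `x_{i+1}` are exchanged
(`IsZeroHecke.cellRows_swap`), and therefore its coordinates satisfy the recursion by divided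
differences: they are the Grothendieck polynomials (`grothendieck_eq_pipeSum`).  Two consequences
are needed.  The coefficients in degree `d` have sign `(-1) ^ (d - inv w)`, so the degree of
`𝔊_w` survives setting all variables equal (`totalDegree_grothendieck`), and after this
specialization the array of factors can be transposed, so `𝔊_w` and `𝔊_{w⁻¹}` have the same
degree (`totalDegree_grothendieck_inv`).

*Lower bound.*  It suffices to choose `raj w` of the factors so that their product involves `e_w`.
This is done row by row, with `rajCode w k` factors from row `k`
(`exists_hasTerm_cellRow_of_lt`, `exists_hasTerm_pipeSum`).

*Upper bound.*  Divided differences do not raise degrees, so the degree of `𝔊_w` is monotone for the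
right weak order and, by the symmetry under inversion, for the left weak order.  If `w` contains the
pattern `132`, then `w` or `w⁻¹` has an ascent that can be exchanged without raising `raj`
(`hasRedundantAscent_of_not_avoids132`, `raj_mul_simple_le`); moving up in this way one arrives at a
permutation avoiding `132`, whose Grothendieck polynomial is the monomial given by its Lehmer code
(`grothendieck_of_avoids132`), and the Lehmer code is bounded by the Rajchgot code.
-/

namespace Rajchgot

/-! ### Levels and the Rajchgot index -/

section Levels

variable {n : ℕ}

theorem card_le_lisFrom {w : Equiv.Perm (Fin n)} {k : Fin n} {S : Finset (Fin n)}
    (h1 : ∀ a ∈ S, k ≤ a) (h2 : k ∈ S) (h3 : ∀ a ∈ S, ∀ b ∈ S, a < b → w a < w b) :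
    S.card ≤ lisFrom w k :=
  Finset.le_sup (f := Finset.card) (Finset.mem_filter.2
    ⟨Finset.mem_powerset.2 fun a ha => Finset.mem_Ici.2 (h1 a ha), h2, h3⟩)

theorem exists_card_eq_lisFrom (w : Equiv.Perm (Fin n)) (k : Fin n) :
    ∃ S : Finset (Fin n), (∀ a ∈ S, k ≤ a) ∧ k ∈ S ∧
      (∀ a ∈ S, ∀ b ∈ S, a < b → w a < w b) ∧ S.card = lisFrom w k := by
  have hne : ((Finset.Ici k).powerset.filter fun S =>
      k ∈ S ∧ ∀ a ∈ S, ∀ b ∈ S, a < b → w a < w b).Nonempty := by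
    refine ⟨{k}, Finset.mem_filter.2 ⟨by simp, by simp, ?_⟩⟩
    intro a ha b hb hab
    simp only [Finset.mem_singleton] at ha hb
    subst ha hb
    exact absurd hab (lt_irrefl _)
  obtain ⟨S, hS, e⟩ := Finset.exists_mem_eq_sup _ hne Finset.card
  obtain ⟨h1, h2, h3⟩ := Finset.mem_filter.1 hS
  exact ⟨S, fun a ha => Finset.mem_Ici.1 (Finset.mem_powerset.1 h1 ha), h2, h3, e.symm⟩

theorem one_le_lisFrom (w : Equiv.Perm (Fin n)) (k : Fin n) : 1 ≤ lisFrom w k := by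
  obtain ⟨S, -, h, -, e⟩ := exists_card_eq_lisFrom w k
  rw [← e]
  exact Finset.card_pos.2 ⟨k, h⟩

theorem lisFrom_lt {w : Equiv.Perm (Fin n)} {p q : Fin n} (hpq : p < q) (hw : w p < w q) :
    lisFrom w q < lisFrom w p := by
  obtain ⟨S, h1, h2, h3, e⟩ := exists_card_eq_lisFrom w q
  have hp : p ∉ S := fun h => absurd (h1 p h) (not_le.2 hpq)
  have hq : ∀ a ∈ S, w q ≤ w a := fun a ha => by
    rcases (h1 a ha).eq_or_lt with h | h
    · rw [h]
    · exact (h3 q h2 a ha h).le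
  rw [← e, ← Nat.succ_le_iff, Nat.succ_eq_add_one, ← Finset.card_insert_of_notMem hp]
  refine card_le_lisFrom ?_ (Finset.mem_insert_self _ _) ?_
  · intro a ha
    rcases Finset.mem_insert.1 ha with rfl | ha
    · exact le_rfl
    · exact hpq.le.trans (h1 a ha)
  · intro a ha b hb hab
    rcases Finset.mem_insert.1 ha with e | ha' <;> rcases Finset.mem_insert.1 hb with e' | hb'
    · exact absurd (e.trans e'.symm) hab.ne
    · rw [e]; exact hw.trans_le (hq b hb')
    · exact absurd (hpq.trans_le (h1 a ha')) (not_lt.2 (e' ▸ hab).le)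
    · exact h3 a ha' b hb' hab

/-- `lisFrom` is the least positive function that strictly decreases towards the southeast; it is
enough to test this on a final segment of positions. -/
theorem lisFrom_le {w : Equiv.Perm (Fin n)} {k : Fin n} {l : Fin n → ℕ}
    (hpos : ∀ p, k ≤ p → 1 ≤ l p)
    (hl : ∀ p q, k ≤ p → p < q → w p < w q → l q < l p) : lisFrom w k ≤ l k := by
  obtain ⟨S, h1, h2, h3, e⟩ := exists_card_eq_lisFrom w k
  have hinj : Set.InjOn l S := by
    intro a ha b hb hab
    by_contra hne
    rcases lt_or_gt_of_ne hne with h | h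
    · exact absurd hab (hl a b (h1 a ha) h (h3 a ha b hb h)).ne'
    · exact absurd hab (hl b a (h1 b hb) h (h3 b hb a ha h)).ne
  have hmaps : Set.MapsTo l S (Finset.Icc 1 (l k)) := by
    intro a ha
    refine Finset.mem_coe.2 (Finset.mem_Icc.2 ⟨hpos a (h1 a ha), ?_⟩)
    rcases (h1 a ha).eq_or_lt with h | h
    · rw [h]
    · exact (hl k a le_rfl h (h3 k h2 a ha h)).le
  have := Finset.card_le_card_of_injOn l hmaps hinj
  rw [← e]
  simpa using this

theorem lisFrom_add_le (w : Equiv.Perm (Fin n)) (k : Fin n) : lisFrom w k + k ≤ n := by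
  have := lisFrom_le (w := w) (k := k) (l := fun p => n - p) (fun p _ => by omega)
    (fun p q _ h _ => by
      have : (p : ℕ) < q := h
      omega)
  omega

theorem exists_lisFrom_succ {w : Equiv.Perm (Fin n)} {k : Fin n} (h : 1 < lisFrom w k) :
    ∃ q, k < q ∧ w k < w q ∧ lisFrom w k = lisFrom w q + 1 := by
  obtain ⟨S, h1, h2, h3, e⟩ := exists_card_eq_lisFrom w k
  have hcard := Finset.card_erase_of_mem h2
  have hne : (S.erase k).Nonempty := Finset.card_pos.1 (by omega)
  have hq := (S.erase k).min'_mem hne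
  set q := (S.erase k).min' hne with hqdef
  have hqS := Finset.mem_of_mem_erase hq
  have hkq : k < q := lt_of_le_of_ne (h1 q hqS) (Finset.ne_of_mem_erase hq).symm
  have hw := h3 k h2 q hqS hkq
  have l1 := lisFrom_lt hkq hw
  have l2 : (S.erase k).card ≤ lisFrom w q :=
    card_le_lisFrom (fun a ha => Finset.min'_le _ a ha) hq
      (fun a ha b hb => h3 a (Finset.mem_of_mem_erase ha) b (Finset.mem_of_mem_erase hb))
  exact ⟨q, hkq, hw, by omega⟩

theorem exists_lisFrom_eq {w : Equiv.Perm (Fin n)} {k : Fin n} {d : ℕ} (hd : 1 ≤ d)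
    (h : d < lisFrom w k) : ∃ q, k < q ∧ w k < w q ∧ lisFrom w q = d := by
  induction hm : lisFrom w k using Nat.strong_induction_on generalizing k with
  | _ m ih =>
    obtain ⟨q, h1, h2, h3⟩ := exists_lisFrom_succ (lt_of_le_of_lt hd h)
    rcases Nat.lt_or_ge d (lisFrom w q) with h4 | h4
    · obtain ⟨r, h5, h6, h7⟩ := ih (lisFrom w q) (by omega) h4 rfl
      exact ⟨r, h1.trans h5, h2.trans h6, h7⟩
    · exact ⟨q, h1, h2, by omega⟩

theorem rajCode_add (w : Equiv.Perm (Fin n)) (k : Fin n) : rajCode w k + lisFrom w k = n - k := by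
  have := lisFrom_add_le w k
  rw [rajCode, Fin.card_Ici]
  omega

theorem raj_add (w : Equiv.Perm (Fin n)) : raj w + ∑ k, lisFrom w k = ∑ k : Fin n, (n - (k : ℕ)) := by
  rw [raj, ← Finset.sum_add_distrib]
  exact Finset.sum_congr rfl fun k _ => rajCode_add w k

theorem lisFrom_inv_le (w : Equiv.Perm (Fin n)) (k : Fin n) :
    lisFrom w⁻¹ (w k) ≤ lisFrom w k := by
  have := lisFrom_le (w := w⁻¹) (k := w k) (l := fun c => lisFrom w (w⁻¹ c))
    (fun p _ => one_le_lisFrom _ _) (fun p q _ h1 h2 => lisFrom_lt h2 (by simpa using h1))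
  simpa using this

theorem lisFrom_inv (w : Equiv.Perm (Fin n)) (k : Fin n) :
    lisFrom w⁻¹ (w k) = lisFrom w k := by
  refine le_antisymm (lisFrom_inv_le w k) ?_
  have := lisFrom_inv_le w⁻¹ (w k)
  simpa using this

theorem sum_lisFrom_inv (w : Equiv.Perm (Fin n)) :
    ∑ k, lisFrom w⁻¹ k = ∑ k, lisFrom w k := by
  rw [← Equiv.sum_comp w]
  exact Finset.sum_congr rfl fun k _ => lisFrom_inv w k

theorem raj_inv (w : Equiv.Perm (Fin n)) : raj w⁻¹ = raj w := by
  have h1 := raj_add w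
  have h2 := raj_add w⁻¹
  rw [sum_lisFrom_inv] at h2
  omega

end Levels

/-! ### Weak order -/

section WeakOrder

variable {n : ℕ}

theorem apply_inv_apply (w : Equiv.Perm (Fin n)) (k : Fin n) : w (w⁻¹ k) = k :=
  Equiv.apply_symm_apply w k

theorem inv_apply_apply (w : Equiv.Perm (Fin n)) (k : Fin n) : w⁻¹ (w k) = k :=
  Equiv.symm_apply_apply w k

theorem inv_inverse (w : Equiv.Perm (Fin n)) : inv w⁻¹ = inv w := by
  refine Finset.card_bij' (fun p _ => (w⁻¹ p.2, w⁻¹ p.1)) (fun p _ => (w p.2, w p.1)) ?_ ?_ ?_ ?_ <;>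
    simp +contextual

/-- The length of `u⁻¹ w` is the number of pairs of values that occur in different orders in the
one-line notations of `u` and `w`. -/
theorem inv_inv_mul (u w : Equiv.Perm (Fin n)) :
    inv (u⁻¹ * w) =
      (Finset.univ.filter fun p : Fin n × Fin n =>
        (p.1 < p.2 ∧ u⁻¹ p.2 < u⁻¹ p.1) ∧ ¬ (p.1 < p.2 ∧ w⁻¹ p.2 < w⁻¹ p.1)).card +
      (Finset.univ.filter fun p : Fin n × Fin n =>
        (p.1 < p.2 ∧ w⁻¹ p.2 < w⁻¹ p.1) ∧ ¬ (p.1 < p.2 ∧ u⁻¹ p.2 < u⁻¹ p.1)).card := by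
  rw [inv, ← Finset.card_filter_add_card_filter_not (p := fun p : Fin n × Fin n => w p.1 < w p.2),
    Finset.filter_filter, Finset.filter_filter]
  congr 1
  · refine Finset.card_bij' (fun p _ => (w p.1, w p.2)) (fun p _ => (w⁻¹ p.1, w⁻¹ p.2)) ?_ ?_ ?_ ?_
    · rintro ⟨a, b⟩ h
      replace h := (Finset.mem_filter.1 h).2
      refine Finset.mem_filter.2 ⟨Finset.mem_univ _, ?_⟩
      simp only [not_and, not_lt, Equiv.Perm.mul_apply, inv_apply_apply] at h ⊢
      exact ⟨⟨h.2, h.1.2⟩, fun _ => h.1.1.le⟩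
    · rintro ⟨a, b⟩ h
      replace h := (Finset.mem_filter.1 h).2
      refine Finset.mem_filter.2 ⟨Finset.mem_univ _, ?_⟩
      simp only [not_and, not_lt, Equiv.Perm.mul_apply, apply_inv_apply] at h ⊢
      refine ⟨⟨lt_of_le_of_ne (h.2 h.1.1) fun e => ?_, h.1.2⟩, h.1.1⟩
      exact absurd (w⁻¹.injective e) h.1.1.ne
    · simp
    · simp
  · refine Finset.card_bij' (fun p _ => (w p.2, w p.1)) (fun p _ => (w⁻¹ p.2, w⁻¹ p.1)) ?_ ?_ ?_ ?_
    · rintro ⟨a, b⟩ h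
      simp only [Finset.mem_filter, Finset.mem_univ, true_and, not_and, not_lt,
        Equiv.Perm.mul_apply, inv_apply_apply] at h ⊢
      refine ⟨⟨lt_of_le_of_ne h.2 fun e => ?_, h.1.1⟩, fun _ => h.1.2.le⟩
      exact absurd (w.injective e) h.1.1.ne'
    · rintro ⟨a, b⟩ h
      simp only [Finset.mem_filter, Finset.mem_univ, true_and, not_and, not_lt,
        Equiv.Perm.mul_apply, apply_inv_apply] at h ⊢
      refine ⟨⟨h.1.2, lt_of_le_of_ne (h.2 h.1.1) fun e => ?_⟩, h.1.1.le⟩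
      exact absurd (u⁻¹.injective e) h.1.1.ne
    · simp
    · simp

theorem rightWeakLE_iff (u w : Equiv.Perm (Fin n)) :
    RightWeakLE u w ↔ ∀ a b, a < b → u⁻¹ b < u⁻¹ a → w⁻¹ b < w⁻¹ a := by
  have e : RightWeakLE u w ↔ inv w = inv u + inv (u⁻¹ * w) := by
    constructor
    · rintro ⟨v, rfl, h⟩
      rwa [inv_mul_cancel_left]
    · intro h
      exact ⟨u⁻¹ * w, by rw [mul_inv_cancel_left], h⟩
  rw [e, inv_inv_mul, ← inv_inverse w, ← inv_inverse u, inv, inv]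
  have h1 := Finset.card_filter_add_card_filter_not
    (s := Finset.univ.filter fun p : Fin n × Fin n => p.1 < p.2 ∧ u⁻¹ p.2 < u⁻¹ p.1)
    (p := fun p : Fin n × Fin n => p.1 < p.2 ∧ w⁻¹ p.2 < w⁻¹ p.1)
  have h2 := Finset.card_filter_add_card_filter_not
    (s := Finset.univ.filter fun p : Fin n × Fin n => p.1 < p.2 ∧ w⁻¹ p.2 < w⁻¹ p.1)
    (p := fun p : Fin n × Fin n => p.1 < p.2 ∧ u⁻¹ p.2 < u⁻¹ p.1)
  rw [Finset.filter_filter, Finset.filter_filter] at h1 h2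
  have h3 : (Finset.univ.filter fun p : Fin n × Fin n =>
      (p.1 < p.2 ∧ u⁻¹ p.2 < u⁻¹ p.1) ∧ (p.1 < p.2 ∧ w⁻¹ p.2 < w⁻¹ p.1)).card =
      (Finset.univ.filter fun p : Fin n × Fin n =>
      (p.1 < p.2 ∧ w⁻¹ p.2 < w⁻¹ p.1) ∧ (p.1 < p.2 ∧ u⁻¹ p.2 < u⁻¹ p.1)).card := by
    simp only [and_comm]
  have h4 : (∀ a b, a < b → u⁻¹ b < u⁻¹ a → w⁻¹ b < w⁻¹ a) ↔
      (Finset.univ.filter fun p : Fin n × Fin n =>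
        (p.1 < p.2 ∧ u⁻¹ p.2 < u⁻¹ p.1) ∧ ¬ (p.1 < p.2 ∧ w⁻¹ p.2 < w⁻¹ p.1)).card = 0 := by
    rw [Finset.card_eq_zero, Finset.filter_eq_empty_iff]
    constructor
    · rintro h ⟨a, b⟩ - ⟨h5, h6⟩
      exact h6 ⟨h5.1, h a b h5.1 h5.2⟩
    · intro h a b h5 h6
      by_contra h7
      exact h (Finset.mem_univ (a, b)) ⟨⟨h5, h6⟩, fun h8 => h7 h8.2⟩
  rw [h4]
  omega

theorem leftWeakLE_iff_inv (u w : Equiv.Perm (Fin n)) :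
    LeftWeakLE u w ↔ RightWeakLE u⁻¹ w⁻¹ := by
  constructor
  · rintro ⟨v, rfl, h⟩
    exact ⟨v⁻¹, by rw [mul_inv_rev], by rw [inv_inverse, inv_inverse, inv_inverse, h, add_comm]⟩
  · rintro ⟨v, h1, h2⟩
    refine ⟨v⁻¹, ?_, by rw [inv_inverse, inv_inverse] at h2; rw [inv_inverse, h2, add_comm]⟩
    rw [← inv_inj, mul_inv_rev, inv_inv, h1]

theorem raj_mono {u w : Equiv.Perm (Fin n)} (h : RightWeakLE u w) : raj u ≤ raj w := by
  rw [rightWeakLE_iff] at h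
  have key : ∀ k, lisFrom w k ≤ lisFrom u (u⁻¹ (w k)) := fun k =>
    lisFrom_le (l := fun k => lisFrom u (u⁻¹ (w k))) (fun p _ => one_le_lisFrom _ _)
      (fun p q _ h1 h2 => lisFrom_lt
        (lt_of_le_of_ne (not_lt.1 fun h3 => absurd (h _ _ h2 h3) (by simpa using h1.le))
          fun e => absurd (u⁻¹.injective e) h2.ne) (by simpa using h2))
  have h1 : ∑ k, lisFrom w k ≤ ∑ k, lisFrom u k := by
    refine (Finset.sum_le_sum fun k _ => key k).trans_eq ?_
    exact Equiv.sum_comp (u⁻¹ * w) (lisFrom u)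
  have h2 := raj_add u
  have h3 := raj_add w
  omega

end WeakOrder

/-! ### The major index -/

section MajorIndex

variable {n : ℕ}

theorem pos_lt_posSucc (j : Fin (n - 1)) : pos j < posSucc j := Nat.lt_succ_self (j : ℕ)

theorem exists_pos_posSucc {p q : Fin n} (h : (q : ℕ) = p + 1) :
    ∃ j : Fin (n - 1), pos j = p ∧ posSucc j = q :=
  ⟨⟨p, by omega⟩, rfl, Fin.ext (by simp [posSucc, h])⟩

theorem majCode_pos (w : Equiv.Perm (Fin n)) (j : Fin (n - 1)) :
    majCode w (pos j) = majCode w (posSucc j) + if w (posSucc j) < w (pos j) then 1 else 0 := by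
  have key : ∀ i : Fin (n - 1), pos j ≤ pos i ↔ posSucc j ≤ pos i ∨ i = j := fun i => by
    simp only [pos, posSucc, Fin.le_def, Fin.ext_iff]
    omega
  have hd : Disjoint
      (Finset.univ.filter fun i : Fin (n - 1) => posSucc j ≤ pos i ∧ w (posSucc i) < w (pos i))
      (Finset.univ.filter fun i : Fin (n - 1) => i = j ∧ w (posSucc i) < w (pos i)) := by
    rw [Finset.disjoint_filter]
    rintro i - ⟨h, -⟩ ⟨rfl, -⟩
    exact absurd h (not_le.2 (pos_lt_posSucc i))
  have h1 : (Finset.univ.filter fun i : Fin (n - 1) => i = j ∧ w (posSucc i) < w (pos i)).card =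
      if w (posSucc j) < w (pos j) then 1 else 0 := by
    rw [← Finset.filter_filter, Finset.filter_eq' Finset.univ j, if_pos (Finset.mem_univ j),
      Finset.filter_singleton]
    split_ifs <;> rfl
  rw [majCode, majCode, ← h1, ← Finset.card_union_of_disjoint hd, ← Finset.filter_or]
  congr 1
  ext i
  simp only [Finset.mem_filter, Finset.mem_univ, true_and, key]
  tauto

theorem majCode_lt_or (w : Equiv.Perm (Fin n)) {p q : Fin n} (h : p ≤ q) :
    majCode w p + p < majCode w q + q ∨ (majCode w p + p = majCode w q + q ∧ w q ≤ w p) := by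
  obtain ⟨d, hd⟩ := Nat.exists_eq_add_of_le (show (p : ℕ) ≤ q from h)
  induction d generalizing q with
  | zero =>
    obtain rfl : p = q := Fin.ext (by omega)
    exact Or.inr ⟨rfl, le_rfl⟩
  | succ d ih =>
    let r : Fin n := ⟨p + d, by omega⟩
    obtain ⟨j, e1, e2⟩ := exists_pos_posSucc (p := r) (q := q) (by simp [r]; omega)
    have h1 := ih (q := r) (Fin.le_def.2 (by simp [r])) rfl
    have h2 := majCode_pos w j
    rw [e1, e2] at h2
    have h3 : (r : ℕ) = p + d := rfl
    split_ifs at h2 with h4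
    · rcases h1 with h1 | ⟨h1, h5⟩
      · left; omega
      · exact Or.inr ⟨by omega, h4.le.trans h5⟩
    · left; omega

theorem majCode_add_lt (w : Equiv.Perm (Fin n)) (p : Fin n) : majCode w p + p < n := by
  have hp := p.2
  let q : Fin n := ⟨n - 1, by omega⟩
  have h0 : majCode w q = 0 := by
    rw [majCode, Finset.card_eq_zero, Finset.filter_eq_empty_iff]
    rintro j - ⟨h, -⟩
    have h1 : n - 1 ≤ j := h
    omega
  have hq : (q : ℕ) = n - 1 := rfl
  rcases majCode_lt_or w (p := p) (q := q) (Fin.le_def.2 (by omega)) with h | ⟨h, -⟩ <;> omega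

theorem lisFrom_add_majCode_le (w : Equiv.Perm (Fin n)) (k : Fin n) :
    lisFrom w k + majCode w k ≤ n - k := by
  have := lisFrom_le (w := w) (k := k) (l := fun p => n - (majCode w p + p))
    (fun p _ => by have := majCode_add_lt w p; omega)
    (fun p q _ h1 h2 => by
      have h3 := majCode_add_lt w q
      rcases majCode_lt_or w h1.le with h | ⟨-, h⟩
      · omega
      · exact absurd h2 (not_lt.2 h))
  have h4 := majCode_add_lt w k
  omega

theorem maj_le_raj (w : Equiv.Perm (Fin n)) : maj w ≤ raj w := by
  refine Finset.sum_le_sum fun k _ => ?_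
  have h1 := lisFrom_add_majCode_le w k
  have h2 := rajCode_add w k
  omega

/-- If the values of `v` are labelled so that along the word of `v` the labels decrease weakly, and
strictly at each ascent, then every tail of `v` has at most as many ascents as its first label
allows. -/
theorem le_majCode_add (v : Equiv.Perm (Fin n)) (l : Fin n → ℕ) (hpos : ∀ p, 1 ≤ l p)
    (hl : ∀ p q, p < q → l q < l p ∨ (l q = l p ∧ v q < v p)) (k : Fin n) :
    n - k ≤ majCode v k + l k := by
  obtain ⟨d, hd⟩ := Nat.exists_eq_add_of_lt k.2
  induction d generalizing k with
  | zero =>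
    have := hpos k
    omega
  | succ d ih =>
    obtain ⟨j, e1, e2⟩ := exists_pos_posSucc (p := k) (q := ⟨k + 1, by omega⟩) rfl
    have h1 := ih (posSucc j) (by rw [e2]; simp only; omega)
    have h2 := majCode_pos v j
    have h3 := hl _ _ (pos_lt_posSucc j)
    have h4 : ((posSucc j : Fin n) : ℕ) = k + 1 := by rw [e2]
    rw [e1] at h2 h3
    split_ifs at h2 with h5
    · omega
    · rcases h3 with h3 | ⟨-, h3⟩
      · omega
      · exact absurd h3 h5

end MajorIndex

/-! ### The fireworks map -/

section FireworksMap

variable {n : ℕ}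

theorem mem_unlassoed (w : Equiv.Perm (Fin n)) (d : ℕ) (k : Fin n) :
    k ∈ unlassoed w d ↔ d < lisFrom w k := by
  induction d generalizing k with
  | zero =>
    have := one_le_lisFrom w k
    simp only [unlassoed, Finset.mem_univ, true_iff]
    omega
  | succ d ih =>
    simp only [unlassoed, southeast, Finset.mem_sdiff, Finset.mem_filter, not_and, not_forall,
      not_not, ih, exists_prop]
    constructor
    · rintro ⟨h1, h2⟩
      obtain ⟨q, h3, h4, h5⟩ := h2 h1
      have := lisFrom_lt h4 h5
      omega
    · intro h
      refine ⟨by omega, fun _ => ?_⟩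
      obtain ⟨q, h1, h2, h3⟩ := exists_lisFrom_succ (w := w) (k := k) (by omega)
      exact ⟨q, by omega, h1, h2⟩

/-- The blobs are the sets of dots on which `lisFrom` is constant. -/
theorem mem_blob (w : Equiv.Perm (Fin n)) (d : ℕ) (k : Fin n) :
    k ∈ blob w d ↔ lisFrom w k = d + 1 := by
  have h1 := mem_unlassoed w (d + 1) k
  have h2 := mem_unlassoed w d k
  have h3 : k ∈ blob w d → k ∈ unlassoed w d := fun h => Finset.mem_of_mem_filter k h
  simp only [unlassoed, Finset.mem_sdiff] at h1
  change (k ∈ unlassoed w d ∧ k ∉ blob w d) ↔ _ at h1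
  rw [h2] at h1 h3
  by_cases h : k ∈ blob w d
  · have := h3 h
    simp only [h, not_true_eq_false, and_false, false_iff, true_iff] at h1 ⊢
    omega
  · simp only [h, not_false_eq_true, and_true, false_iff] at h1 ⊢
    omega

theorem mem_part_setPartition (w : Equiv.Perm (Fin n)) (a b : Fin n) :
    b ∈ (setPartition w).part a ↔ lisFrom w (w⁻¹ b) = lisFrom w (w⁻¹ a) := by
  have hcols : ∀ d c, c ∈ blobCols w d ↔ lisFrom w (w⁻¹ c) = d + 1 := fun d c => by
    rw [← mem_blob, blobCols, Finset.mem_map_equiv]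
    rfl
  have h1 := (setPartition w).part_mem.2 (Finset.mem_univ a)
  have h2 := (setPartition w).mem_part (Finset.mem_univ a)
  obtain ⟨d, -, hd⟩ := Finset.mem_image.1 (Finset.mem_of_mem_erase h1)
  rw [← hd, hcols] at h2
  rw [← hd, hcols, h2]

/-- Two letters of the word of a set partition stand in decreasing order if they belong to the same
block, and otherwise the largest element of the first block is smaller than that of the second. -/
theorem ofPartition_apply_lt (P : Finpartition (Finset.univ : Finset (Fin n))) {p q : Fin n}
    (h : p < q) :
    (ofPartition P q ∈ P.part (ofPartition P p) ∧ ofPartition P q < ofPartition P p) ∨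
      ∃ c ∈ P.part (ofPartition P p), ∃ d ∈ P.part (ofPartition P q),
        (∀ b ∈ P.part c, b ≤ c) ∧ (∀ b ∈ P.part d, b ≤ d) ∧ c < d := by
  have key : (partitionWord P).Pairwise fun a b => (b ∈ P.part a ∧ b < a) ∨
      ∃ c ∈ P.part a, ∃ d ∈ P.part b,
        (∀ b ∈ P.part c, b ≤ c) ∧ (∀ b ∈ P.part d, b ≤ d) ∧ c < d := by
    have hself : ∀ {a c : Fin n}, a ∈ P.part c → P.part a = P.part c := fun {a c} hac =>
      P.part_eq_of_mem (P.part_mem.2 (Finset.mem_univ c)) hac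
    rw [partitionWord, List.pairwise_flatMap]
    constructor
    · intro c _
      refine (List.Pairwise.imp_of_mem ?_ (P.part c).sortedGT_sort.pairwise)
      intro a b ha hb hab
      rw [Finset.mem_sort] at ha hb
      exact Or.inl ⟨by rw [hself ha]; exact hb, hab⟩
    · refine List.Pairwise.imp_of_mem ?_ ((List.pairwise_lt_finRange n).filter _)
      intro c d hc hd hcd a ha b hb
      rw [Finset.mem_sort] at ha hb
      refine Or.inr ⟨c, ?_, d, ?_, by simpa using (List.mem_filter.1 hc).2,
        by simpa using (List.mem_filter.1 hd).2, hcd⟩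
      · rw [hself ha]; exact P.mem_part (Finset.mem_univ c)
      · rw [hself hb]; exact P.mem_part (Finset.mem_univ d)
  rw [List.pairwise_iff_get] at key
  exact key (Fin.cast (partitionWord_length P) p) (Fin.cast (partitionWord_length P) q) h

theorem fireworks_label (w : Equiv.Perm (Fin n)) {p q : Fin n} (h : p < q) :
    lisFrom w (w⁻¹ (fireworks w q)) < lisFrom w (w⁻¹ (fireworks w p)) ∨
      (lisFrom w (w⁻¹ (fireworks w q)) = lisFrom w (w⁻¹ (fireworks w p)) ∧
        fireworks w q < fireworks w p) := by
  rcases ofPartition_apply_lt (setPartition w) h with ⟨h1, h2⟩ | ⟨c, hc, d, hd, hcmax, hdmax, hcd⟩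
  · exact Or.inr ⟨(mem_part_setPartition _ _ _).1 h1, h2⟩
  · left
    rw [mem_part_setPartition] at hc hd
    change lisFrom w _ = lisFrom w (w⁻¹ (fireworks w p)) at hc
    change lisFrom w _ = lisFrom w (w⁻¹ (fireworks w q)) at hd
    rw [← hc, ← hd]
    by_contra! hle
    -- the largest element `c` of its block would be smaller than an element of the same block
    have : ∃ e, d ≤ e ∧ lisFrom w (w⁻¹ e) = lisFrom w (w⁻¹ c) := by
      rcases hle.eq_or_lt with hle | hlt
      · exact ⟨d, le_rfl, hle.symm⟩
      · obtain ⟨r, -, h2, h3⟩ := exists_lisFrom_eq (one_le_lisFrom w _) hlt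
        exact ⟨w r, by simpa using h2.le, by simpa using h3⟩
    obtain ⟨e, hde, he⟩ := this
    exact absurd (hcmax e ((mem_part_setPartition _ _ _).2 he)) (not_le.2 (hcd.trans_le hde))

theorem fireworks_rightWeakLE (w : Equiv.Perm (Fin n)) : RightWeakLE (fireworks w) w := by
  rw [rightWeakLE_iff]
  intro a b hab h
  have h1 := fireworks_label w h
  simp only [apply_inv_apply] at h1
  by_contra h2
  have h3 : w⁻¹ a < w⁻¹ b :=
    lt_of_le_of_ne (not_lt.1 h2) fun e => hab.ne (w⁻¹.injective e)
  have h4 := lisFrom_lt (w := w) h3 (by simpa using hab)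
  omega

theorem maj_fireworks (w : Equiv.Perm (Fin n)) : maj (fireworks w) = raj w := by
  refine le_antisymm ((maj_le_raj _).trans (raj_mono (fireworks_rightWeakLE w))) ?_
  have h1 := le_majCode_add (fireworks w) (fun p => lisFrom w (w⁻¹ (fireworks w p)))
    (fun p => one_le_lisFrom _ _) (fun p q h => fireworks_label w h)
  have h2 := Finset.sum_le_sum fun k (_ : k ∈ Finset.univ) => h1 k
  have h3 : ∑ p, lisFrom w (w⁻¹ (fireworks w p)) = ∑ p, lisFrom w p :=
    Equiv.sum_comp (w⁻¹ * fireworks w) (lisFrom w)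
  rw [Finset.sum_add_distrib, h3, ← raj_add w] at h2
  exact Nat.le_of_add_le_add_right h2

end FireworksMap

/-! ### Products in the 0-Hecke algebra -/

section HeckeProducts

variable {S E : Type*} [CommRing S] [Ring E] [Algebra S E]

/-- The relations of the generators of the 0-Hecke algebra, normalized so that `-T i` is
idempotent. -/
structure IsZeroHecke (T : ℕ → E) : Prop where
  sq : ∀ i, T i * T i = -T i
  comm : ∀ i j, i + 1 < j → T i * T j = T j * T i
  braid : ∀ i, T i * (T (i + 1) * T i) = T (i + 1) * (T i * T (i + 1))

/-- The factor `1 + x T_i`, which corresponds to one cell of a pipe dream. -/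
def cell (T : ℕ → E) (i : ℕ) (x : S) : E := 1 + x • T i

/-- The product `(1 + x T_{i+l-1}) ⋯ (1 + x T_{i+1}) (1 + x T_i)`. -/
def cellRow (T : ℕ → E) : ℕ → ℕ → S → E
  | _, 0, _ => 1
  | i, l + 1, x => cellRow T (i + 1) l x * cell T i x

/-- The product `(1 + x T_i) (1 + x T_{i+1}) ⋯ (1 + x T_{i+l-1})`. -/
def cellCol (T : ℕ → E) : ℕ → ℕ → S → E
  | _, 0, _ => 1
  | i, l + 1, x => cell T i x * cellCol T (i + 1) l x

/-- The product of `cellRow T i l (x i)`, `cellRow T (i + 1) (l - 1) (x (i + 1))`, …: the factors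
of a triangular array of cells, read row by row and from right to left in each row. -/
def cellRows (T : ℕ → E) (x : ℕ → S) : ℕ → ℕ → E
  | _, 0 => 1
  | i, l + 1 => cellRow T i (l + 1) (x i) * cellRows T x (i + 1) l

theorem cellRow_succ (T : ℕ → E) (i l : ℕ) (x : S) :
    cellRow T i (l + 1) x = cellRow T (i + 1) l x * cell T i x := rfl

theorem cellCol_succ (T : ℕ → E) (i l : ℕ) (x : S) :
    cellCol T i (l + 1) x = cell T i x * cellCol T (i + 1) l x := rfl

theorem cellRows_succ (T : ℕ → E) (x : ℕ → S) (i l : ℕ) :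
    cellRows T x i (l + 1) = cellRow T i (l + 1) (x i) * cellRows T x (i + 1) l := rfl

theorem cellRows_eq (T : ℕ → E) (x : ℕ → S) (i l : ℕ) :
    cellRows T x i l = cellRow T i l (x i) * cellRows T x (i + 1) (l - 1) := by
  cases l with
  | zero => exact (one_mul _).symm
  | succ l => rfl

theorem cellRows_congr (T : ℕ → E) {x y : ℕ → S} {i : ℕ} (l : ℕ)
    (h : ∀ j, i ≤ j → j < i + l → x j = y j) :
    cellRows T x i l = cellRows T y i l := by
  induction l generalizing i with
  | zero => rfl
  | succ l ih =>
    rw [cellRows_succ, cellRows_succ, h i le_rfl (by omega),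
      ih fun j hj hj' => h j (by omega) (by omega)]

theorem commute_cell {T : ℕ → E} {a : E} {i : ℕ} (h : Commute a (T i)) (x : S) :
    Commute a (cell T i x) :=
  (Commute.one_right a).add_right (h.smul_right x)

theorem commute_cellRow {T : ℕ → E} {a : E} {i : ℕ} (h : ∀ j, i ≤ j → Commute a (T j)) (l : ℕ)
    (x : S) : Commute a (cellRow T i l x) := by
  induction l generalizing i with
  | zero => exact Commute.one_right a
  | succ l ih =>
    exact (ih fun j hj => h j (by omega)).mul_right (commute_cell (h i le_rfl) x)

theorem commute_cellRows {T : ℕ → E} {a : E} {i : ℕ} (h : ∀ j, i ≤ j → Commute a (T j))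
    (x : ℕ → S) (l : ℕ) : Commute a (cellRows T x i l) := by
  induction l generalizing i with
  | zero => exact Commute.one_right a
  | succ l ih =>
    exact (commute_cellRow h _ _).mul_right (ih fun j hj => h j (by omega))

namespace IsZeroHecke

variable {T : ℕ → E}

theorem commute (hT : IsZeroHecke T) {i j k : ℕ} (hk : i + 2 ≤ k) (hj : k ≤ j) : Commute (T i) (T j) :=
  hT.comm i j (by omega)

/-- The Yang–Baxter equation, with denominators cleared. -/
theorem yangBaxter (hT : IsZeroHecke T) (i : ℕ) (x y : S) :
    cell T i x * (cell T (i + 1) y * ((1 - x) • (1 : E) - (x - y) • T i)) =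
      ((1 - x) • (1 : E) - (x - y) • T (i + 1)) * (cell T i y * cell T (i + 1) x) := by
  have ha := hT.sq i
  have hb := hT.sq (i + 1)
  have hbr := hT.braid i
  simp only [cell]
  generalize T i = a at *
  generalize T (i + 1) = b at *
  simp only [mul_add, add_mul, mul_sub, sub_mul, smul_mul_assoc, mul_smul_comm, one_mul, mul_one,
    ha, hb, hbr, smul_neg]
  module

/-- Exchanging the parameters of two consecutive rows. -/
theorem cellRow_exchange (hT : IsZeroHecke T) (i l : ℕ) (x y : S) :
    cellRow T i (l + 1) x * cellRow T (i + 1) l y * ((1 - x) • (1 : E) - (x - y) • T i) =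
      (1 - x) • (cellRow T i (l + 1) y * cellRow T (i + 1) l x) := by
  induction l generalizing i with
  | zero =>
    have ha := hT.sq i
    simp only [cellRow, cell, one_mul, mul_one]
    simp only [add_mul, mul_sub, smul_mul_assoc, mul_smul_comm, one_mul, mul_one, ha]
    module
  | succ l ih =>
    have hc := (commute_cellRow (fun j hj => (commute_cell (hT.commute le_rfl hj).symm x).symm)
      l y : Commute (cell T i x) (cellRow T (i + 1 + 1) l y)).eq
    have hc' := (commute_cellRow (fun j hj => (commute_cell (hT.commute le_rfl hj).symm y).symm)
      l x : Commute (cell T i y) (cellRow T (i + 1 + 1) l x)).eq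
    have h1 : cellRow T i (l + 1 + 1) x * cellRow T (i + 1) (l + 1) y =
        cellRow T (i + 1) (l + 1) x * cellRow T (i + 1 + 1) l y *
          (cell T i x * cell T (i + 1) y) := by
      rw [cellRow_succ T i, cellRow_succ T (i + 1) l y, mul_assoc, ← mul_assoc (cell T i x), hc]
      simp only [mul_assoc]
    have h2 : cellRow T i (l + 1 + 1) y * cellRow T (i + 1) (l + 1) x =
        cellRow T (i + 1) (l + 1) y * cellRow T (i + 1 + 1) l x *
          (cell T i y * cell T (i + 1) x) := by
      rw [cellRow_succ T i, cellRow_succ T (i + 1) l x, mul_assoc, ← mul_assoc (cell T i y), hc']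
      simp only [mul_assoc]
    rw [h1, mul_assoc, mul_assoc (cell T i x), hT.yangBaxter, ← mul_assoc, ih, h2, smul_mul_assoc]

/-- The effect of exchanging two consecutive parameters on `cellRows`; this is what turns the
recursion for `cellRows` in the 0-Hecke algebra into the recursion by divided differences. -/
theorem cellRows_swap (hT : IsZeroHecke T) (x : ℕ → S) {i k l : ℕ} (hk : k ≤ i) (hl : i < k + l) :
    (x i - x (i + 1)) • (cellRows T x k l * (1 + T i)) =
      (1 - x (i + 1)) • cellRows T x k l -
        (1 - x i) • cellRows T (x ∘ Equiv.swap i (i + 1)) k l := by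
  obtain ⟨d, rfl⟩ := Nat.exists_eq_add_of_le hk
  induction d generalizing k l with
  | zero =>
    obtain ⟨l, rfl⟩ : ∃ m, l = m + 1 := ⟨l - 1, by omega⟩
    rw [add_zero]
    have hsplit : ∀ z : ℕ → S, cellRows T z k (l + 1) = cellRow T k (l + 1) (z k) *
        cellRow T (k + 1) l (z (k + 1)) * cellRows T z (k + 2) (l - 1) := fun z => by
      rw [cellRows_succ, cellRows_eq, mul_assoc]
    have htail : cellRows T (x ∘ Equiv.swap k (k + 1)) (k + 2) (l - 1) =
        cellRows T x (k + 2) (l - 1) := by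
      refine cellRows_congr T _ fun j hj _ => ?_
      rw [Function.comp_apply, Equiv.swap_apply_of_ne_of_ne (by omega) (by omega)]
    have hc : Commute (1 + T k) (cellRows T x (k + 2) (l - 1)) :=
      commute_cellRows (fun j hj => (Commute.one_left _).add_left (hT.commute le_rfl hj)) _ _
    have key := hT.cellRow_exchange k l (x k) (x (k + 1))
    rw [hsplit, hsplit, htail, mul_assoc _ _ (1 + T k), ← hc.eq, Function.comp_apply,
      Function.comp_apply, Equiv.swap_apply_left, Equiv.swap_apply_right,
      ← smul_mul_assoc (1 - x k), ← key]
    simp only [mul_add, add_mul, mul_sub, sub_mul, smul_mul_assoc, mul_smul_comm, one_mul, mul_one,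
      mul_assoc]
    module
  | succ d ih =>
    obtain ⟨l, rfl⟩ : ∃ m, l = m + 1 := ⟨l - 1, by omega⟩
    have h1 := ih (k := k + 1) (l := l) (by omega) (by omega)
    rw [show k + 1 + d = k + (d + 1) by omega] at h1
    have h2 : (x ∘ Equiv.swap (k + (d + 1)) (k + (d + 1) + 1)) k = x k := by
      rw [Function.comp_apply, Equiv.swap_apply_of_ne_of_ne (by omega) (by omega)]
    rw [cellRows_succ, cellRows_succ, h2, mul_assoc, ← mul_smul_comm, h1, mul_sub, mul_smul_comm,
      mul_smul_comm]

/-- If all parameters are equal, the triangular array of cells may as well be read column by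
column. -/
theorem cellRows_eq_mul_cellCol (hT : IsZeroHecke T) (t : S) (i l : ℕ) :
    cellRows T (fun _ => t) i (l + 1) =
      cellRows T (fun _ => t) (i + 1) l * cellCol T i (l + 1) t := by
  induction l generalizing i with
  | zero => simp [cellRows, cellRow, cellCol]
  | succ l ih =>
    have hc := (commute_cellRows (fun j hj => (commute_cell (hT.commute le_rfl hj).symm t).symm)
      (fun _ => t) l : Commute (cell T i t) (cellRows T (fun _ => t) (i + 1 + 1) l)).eq
    conv_lhs => rw [cellRows_succ, ih (i + 1), cellRow_succ]
    rw [cellCol_succ T i, cellRows_succ T _ (i + 1) l, mul_assoc, ← mul_assoc (cell T i t), hc]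
    simp only [mul_assoc]

end IsZeroHecke

/-- Conjugating the generators conjugates the products. -/
theorem mul_cellRow {T T' : ℕ → E} {J : E} (h : ∀ i, J * T i = T' i * J) (i l : ℕ) (x : S) :
    J * cellRow T i l x = cellRow T' i l x * J := by
  induction l generalizing i with
  | zero => rw [cellRow, cellRow, mul_one, one_mul]
  | succ l ih =>
    have h1 : J * cell T i x = cell T' i x * J := by
      rw [cell, cell, mul_add, add_mul, mul_one, one_mul, mul_smul_comm, h, smul_mul_assoc]
    rw [cellRow_succ, cellRow_succ, ← mul_assoc, ih, mul_assoc, h1, mul_assoc]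

theorem mul_cellRows {T T' : ℕ → E} {J : E} (h : ∀ i, J * T i = T' i * J) (x : ℕ → S) (i l : ℕ) :
    J * cellRows T x i l = cellRows T' x i l * J := by
  induction l generalizing i with
  | zero => rw [cellRows, cellRows, mul_one, one_mul]
  | succ l ih =>
    rw [cellRows_succ, cellRows_succ, ← mul_assoc, mul_cellRow h, mul_assoc, ih, mul_assoc]

end HeckeProducts

section Bimodule

variable {S V : Type*} [CommRing S] [AddCommGroup V] [Module S V]
  {L R : ℕ → Module.End S V} {e : V}

theorem cell_apply (T : ℕ → Module.End S V) (i : ℕ) (x : S) (v : V) :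
    cell T i x v = v + x • T i v := rfl

theorem cellCol_apply_eq_cellRow (hLR : ∀ i j, Commute (L i) (R j)) (he : ∀ i, L i e = R i e)
    (i l : ℕ) (t : S) : cellCol L i l t e = cellRow R i l t e := by
  induction l generalizing i with
  | zero => rfl
  | succ l ih =>
    have hc : Commute (cell L i t) (cellRow R (i + 1) l t) :=
      commute_cellRow (fun j _ => (commute_cell (hLR i j).symm t).symm) l t
    rw [cellCol_succ, cellRow_succ, Module.End.mul_apply, ih, Module.End.mul_apply,
      ← Module.End.mul_apply, hc.eq, Module.End.mul_apply, cell_apply, cell_apply, he]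

/-- In the regular bimodule of the 0-Hecke algebra, with equal parameters, the products of left and
of right multiplications agree on the unit: transposition of pipe dreams. -/
theorem cellRows_apply_eq (hL : IsZeroHecke L) (hLR : ∀ i j, Commute (L i) (R j))
    (he : ∀ i, L i e = R i e) (t : S) (i l : ℕ) :
    cellRows L (fun _ => t) i l e = cellRows R (fun _ => t) i l e := by
  induction l generalizing i with
  | zero => rfl
  | succ l ih =>
    have hc : Commute (cellRows L (fun _ => t) (i + 1) l) (cellRow R i (l + 1) t) :=
      commute_cellRow (fun j _ => (commute_cellRows (fun k _ => (hLR k j).symm) _ _).symm) _ _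
    rw [hL.cellRows_eq_mul_cellCol, Module.End.mul_apply, cellCol_apply_eq_cellRow hLR he,
      ← Module.End.mul_apply, hc.eq, Module.End.mul_apply, ih, cellRows_succ, Module.End.mul_apply]

end Bimodule

/-! ### The regular bimodule of the 0-Hecke algebra -/

section Regular

variable {n : ℕ} {S : Type*} [CommRing S]

/-- Right multiplication by a generator of the 0-Hecke algebra. A function `f` on permutations
stands for the element with coordinates `f w` in the standard basis `e_w`, and
`e_w T_i = e_{w s_i}` if `i` is an ascent of `w`, `e_w T_i = -e_w` if it is a descent. -/
def rightOp (S : Type*) [CommRing S] (i : Fin (n - 1)) : Module.End S (Equiv.Perm (Fin n) → S) where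
  toFun f w := if w (posSucc i) < w (pos i) then f (w * simple i) - f w else 0
  map_add' f g := by
    funext w
    simp only [Pi.add_apply]
    split_ifs
    · ring
    · rw [add_zero]
  map_smul' c f := by
    funext w
    simp only [Pi.smul_apply, smul_eq_mul, RingHom.id_apply]
    split_ifs
    · ring
    · rw [mul_zero]

theorem rightOp_apply (i : Fin (n - 1)) (f : Equiv.Perm (Fin n) → S) (w : Equiv.Perm (Fin n)) :
    rightOp S i f w = if w (posSucc i) < w (pos i) then f (w * simple i) - f w else 0 := rfl

theorem rightOp_sq (i : Fin (n - 1)) : rightOp S i * rightOp S i = -rightOp S i := by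
  refine LinearMap.ext fun f => funext fun w => ?_
  rw [Module.End.mul_apply, LinearMap.neg_apply, Pi.neg_apply]
  simp only [rightOp_apply, Equiv.Perm.mul_apply, simple_pos, simple_posSucc]
  split_ifs with h1 h2
  · exact absurd h1 (lt_asymm h2)
  · ring
  · ring

theorem rightOp_comm {i j : Fin (n - 1)} (h : (i : ℕ) + 1 < j) :
    rightOp S i * rightOp S j = rightOp S j * rightOp S i := by
  have n1 : pos i ≠ pos j := by simp [pos, Fin.ext_iff]; omega
  have n2 : pos i ≠ posSucc j := by simp [pos, posSucc, Fin.ext_iff]; omega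
  have n3 : posSucc i ≠ pos j := by simp [pos, posSucc, Fin.ext_iff]; omega
  have n4 : posSucc i ≠ posSucc j := by simp [posSucc, Fin.ext_iff]; omega
  refine LinearMap.ext fun f => funext fun w => ?_
  simp only [Module.End.mul_apply, rightOp_apply, Equiv.Perm.mul_apply, simple_of_ne n1 n2,
    simple_of_ne n3 n4, simple_of_ne n1.symm n3.symm, simple_of_ne n2.symm n4.symm, mul_assoc,
    simple_comm h]
  split_ifs <;> ring

theorem rightOp_braid {i j : Fin (n - 1)} (h : (i : ℕ) + 1 = j) :
    rightOp S i * (rightOp S j * rightOp S i) = rightOp S j * (rightOp S i * rightOp S j) := by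
  have e := posSucc_eq_pos h
  have n1 : pos i ≠ pos j := e ▸ pos_ne_posSucc i
  have n2 : pos j ≠ posSucc j := pos_ne_posSucc j
  have n3 : pos i ≠ posSucc j := pos_ne_posSucc_next h
  have ia : simple i (pos i) = pos j := e ▸ simple_pos i
  have ib : simple i (pos j) = pos i := by rw [← e]; exact simple_posSucc i
  have ic : simple i (posSucc j) = posSucc j := simple_of_ne n3.symm (by rw [e]; exact n2.symm)
  have ja : simple j (pos i) = pos i := simple_of_ne n1 n3
  have jb : simple j (pos j) = posSucc j := simple_pos j
  have jc : simple j (posSucc j) = pos j := simple_posSucc j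
  have hb := simple_braid h
  rw [mul_assoc, mul_assoc] at hb
  refine LinearMap.ext fun f => funext fun w => ?_
  simp only [Module.End.mul_apply, rightOp_apply, Equiv.Perm.mul_apply, e, ia, ib, ic, ja, jb, jc,
    mul_assoc, simple_mul_self, hb, mul_one]
  have m1 := fun e' => n1 (w.injective e')
  have m2 := fun e' => n2 (w.injective e')
  have m3 := fun e' => n3 (w.injective e')
  generalize w (pos i) = a at *
  generalize w (pos j) = b at *
  generalize w (posSucc j) = c at *
  rcases lt_or_gt_of_ne m1 with h1 | h1 <;> rcases lt_or_gt_of_ne m2 with h2 | h2 <;>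
    rcases lt_or_gt_of_ne m3 with h3 | h3 <;>
    first
      | exact absurd (h1.trans h2) (lt_asymm h3)
      | exact absurd (h2.trans h1) (lt_asymm h3)
      | (simp only [h1, h2, h3, lt_asymm h1, lt_asymm h2, lt_asymm h3, if_true, if_false] <;> ring)

/-- The generators acting by right multiplication, indexed by all natural numbers; those
beyond the range are zero. -/
def rightGen (n : ℕ) (S : Type*) [CommRing S] (i : ℕ) : Module.End S (Equiv.Perm (Fin n) → S) :=
  if h : i < n - 1 then rightOp S ⟨i, h⟩ else 0

theorem rightGen_coe (i : Fin (n - 1)) : rightGen n S i = rightOp S i := dif_pos i.2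

theorem isZeroHecke_rightGen : IsZeroHecke (rightGen n S) where
  sq i := by
    unfold rightGen
    split_ifs with h
    · exact rightOp_sq _
    · rw [mul_zero, neg_zero]
  comm i j hij := by
    unfold rightGen
    split_ifs with h1 h2
    · exact rightOp_comm hij
    · rw [mul_zero, zero_mul]
    · rw [mul_zero, zero_mul]
    · rfl
  braid i := by
    unfold rightGen
    split_ifs with h1 h2
    · exact rightOp_braid rfl
    · simp
    · omega
    · simp

/-- The linear extension of `e_w ↦ e_{w⁻¹}`. -/
def invOp (n : ℕ) (S : Type*) [CommRing S] : Module.End S (Equiv.Perm (Fin n) → S) :=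
  LinearMap.funLeft S S fun w => w⁻¹

theorem invOp_apply (f : Equiv.Perm (Fin n) → S) (w : Equiv.Perm (Fin n)) :
    invOp n S f w = f w⁻¹ := rfl

theorem invOp_mul_self : invOp n S * invOp n S = 1 :=
  LinearMap.ext fun f => funext fun w => by
    rw [Module.End.mul_apply, invOp_apply, invOp_apply, inv_inv]; rfl

/-- The generators acting by left multiplication. -/
def leftGen (n : ℕ) (S : Type*) [CommRing S] (i : ℕ) : Module.End S (Equiv.Perm (Fin n) → S) :=
  invOp n S * (rightGen n S i * invOp n S)

theorem leftGen_mul_mul (i j : ℕ) :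
    leftGen n S i * leftGen n S j = invOp n S * (rightGen n S i * rightGen n S j * invOp n S) := by
  rw [leftGen, leftGen, mul_assoc, mul_assoc, ← mul_assoc (invOp n S) (invOp n S), invOp_mul_self,
    one_mul, mul_assoc]

theorem invOp_mul_leftGen (i : ℕ) : invOp n S * leftGen n S i = rightGen n S i * invOp n S := by
  rw [leftGen, ← mul_assoc, invOp_mul_self, one_mul]

theorem isZeroHecke_leftGen : IsZeroHecke (leftGen n S) where
  sq i := by
    rw [leftGen_mul_mul]
    exact LinearMap.ext fun f => (congrArg (fun F : Module.End S (Equiv.Perm (Fin n) → S) =>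
      invOp n S (F (invOp n S f))) (isZeroHecke_rightGen.sq i)).trans (map_neg (invOp n S) _)
  comm i j hij := by rw [leftGen_mul_mul, leftGen_mul_mul, isZeroHecke_rightGen.comm i j hij]
  braid i := by
    have h : ∀ i j, leftGen n S i * (leftGen n S j * leftGen n S i) = invOp n S *
        (rightGen n S i * (rightGen n S j * rightGen n S i) * invOp n S) := fun i j => by
      rw [leftGen_mul_mul, leftGen, mul_assoc, mul_assoc, ← mul_assoc (invOp n S) (invOp n S),
        invOp_mul_self, one_mul]
      simp only [mul_assoc]
    rw [h, h, isZeroHecke_rightGen.braid]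

theorem simple_inv (i : Fin (n - 1)) : (simple i)⁻¹ = simple i := Equiv.swap_inv _ _

theorem leftGen_apply (i : Fin (n - 1)) (f : Equiv.Perm (Fin n) → S) (w : Equiv.Perm (Fin n)) :
    leftGen n S i f w =
      if w⁻¹ (posSucc i) < w⁻¹ (pos i) then f (simple i * w) - f w else 0 := by
  rw [leftGen, Module.End.mul_apply, Module.End.mul_apply, invOp_apply, rightGen_coe,
    rightOp_apply, invOp_apply, invOp_apply, mul_inv_rev, simple_inv, inv_inv]

theorem leftGen_of_le {i : ℕ} (h : n - 1 ≤ i) : leftGen n S i = 0 := by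
  rw [leftGen, rightGen, dif_neg (by omega), zero_mul, mul_zero]

theorem val_simple (j : Fin (n - 1)) (a : Fin n) :
    (simple j a : ℕ) = if (a : ℕ) = j then (j : ℕ) + 1 else if (a : ℕ) = j + 1 then (j : ℕ) else a := by
  by_cases h1 : a = pos j
  · rw [h1, simple_pos, if_pos (show ((pos j : Fin n) : ℕ) = j from rfl)]
    rfl
  · have h1' : (a : ℕ) ≠ j := fun h => h1 (Fin.ext h)
    by_cases h2 : a = posSucc j
    · have h2' : (a : ℕ) = j + 1 := by rw [h2]; rfl
      rw [if_neg h1', if_pos h2', h2, simple_posSucc]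
      rfl
    · have h2' : (a : ℕ) ≠ j + 1 := fun h => h2 (Fin.ext h)
      rw [if_neg h1', if_neg h2', simple_of_ne h1 h2]

theorem simple_lt_simple_iff {a b : Fin n} {j : Fin (n - 1)}
    (h1 : ¬ (a = pos j ∧ b = posSucc j)) (h2 : ¬ (a = posSucc j ∧ b = pos j)) :
    simple j a < simple j b ↔ a < b := by
  simp only [pos, posSucc, Fin.ext_iff] at h1 h2
  rw [Fin.lt_def, Fin.lt_def, val_simple, val_simple]
  split_ifs <;> omega

theorem commute_leftGen_rightOp (i j : Fin (n - 1)) :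
    Commute (leftGen n S i) (rightOp S j) := by
  refine LinearMap.ext fun f => funext fun w => ?_
  rw [Module.End.mul_apply, Module.End.mul_apply, leftGen_apply, rightOp_apply]
  simp only [leftGen_apply, rightOp_apply, mul_inv_rev, simple_inv, Equiv.Perm.mul_apply]
  have hd := pos_lt_posSucc j
  have hd' := pos_lt_posSucc i
  by_cases h1 : w (pos j) = pos i ∧ w (posSucc j) = posSucc i
  · have e1 : w⁻¹ (pos i) = pos j := by rw [← h1.1, inv_apply_apply]
    have e2 : w⁻¹ (posSucc i) = posSucc j := by rw [← h1.2, inv_apply_apply]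
    simp only [h1.1, h1.2, e1, e2, hd.asymm, hd'.asymm, if_false]
  by_cases h2 : w (pos j) = posSucc i ∧ w (posSucc j) = pos i
  · have e1 : w⁻¹ (posSucc i) = pos j := by rw [← h2.1, inv_apply_apply]
    have e2 : w⁻¹ (pos i) = posSucc j := by rw [← h2.2, inv_apply_apply]
    have e3 : w * simple j = simple i * w := by
      rw [simple, simple, Equiv.mul_swap_eq_swap_mul, h2.1, h2.2, Equiv.swap_comm]
    simp only [h2.1, h2.2, e1, e2, hd, hd', simple_posSucc, simple_pos, hd.asymm, hd'.asymm,
      if_true, if_false, e3]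
  · have h3 := simple_lt_simple_iff (a := w (posSucc j)) (b := w (pos j)) (j := i)
      (fun h => h2 ⟨h.2, h.1⟩) (fun h => h1 ⟨h.2, h.1⟩)
    have h4 := simple_lt_simple_iff (a := w⁻¹ (posSucc i)) (b := w⁻¹ (pos i)) (j := j)
      (fun h => h2 ⟨by rw [← h.1, apply_inv_apply], by rw [← h.2, apply_inv_apply]⟩)
      (fun h => h1 ⟨by rw [← h.2, apply_inv_apply], by rw [← h.1, apply_inv_apply]⟩)
    simp only [h3, h4, mul_assoc]
    split_ifs <;> ring

theorem commute_leftGen_rightGen (i j : ℕ) : Commute (leftGen n S i) (rightGen n S j) := by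
  rcases Nat.lt_or_ge i (n - 1) with hi | hi
  · rw [rightGen]
    split_ifs with hj
    · exact commute_leftGen_rightOp ⟨i, hi⟩ ⟨j, hj⟩
    · exact Commute.zero_right _
  · rw [leftGen_of_le hi]
    exact Commute.zero_left _

theorem leftGen_single_one (i : ℕ) :
    leftGen n S i (Pi.single 1 1) = rightGen n S i (Pi.single 1 1) := by
  rcases Nat.lt_or_ge i (n - 1) with hi | hi
  · lift i to Fin (n - 1) using hi
    funext w
    have hd := pos_lt_posSucc i
    rw [leftGen_apply, rightGen_coe, rightOp_apply]
    by_cases h1 : w = 1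
    · subst h1
      simp only [inv_one, Equiv.Perm.one_apply, hd.asymm, if_false]
    · by_cases h2 : w = simple i
      · rw [h2, simple_inv]
      · have h3 : simple i * w ≠ 1 := fun h => h2 (by
          rw [← one_mul w, ← simple_mul_self i, mul_assoc, h, mul_one])
        have h4 : w * simple i ≠ 1 := fun h => h2 (by
          rw [← mul_simple_simple w i, h, one_mul])
        rw [Pi.single_eq_of_ne h3, Pi.single_eq_of_ne h4, Pi.single_eq_of_ne h1, sub_self,
          ite_self, ite_self]
  · rw [leftGen_of_le hi, rightGen, dif_neg (by omega)]

theorem invOp_single_one : invOp n S (Pi.single 1 1) = Pi.single 1 1 := by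
  funext w
  rw [invOp_apply, Pi.single_apply, Pi.single_apply]
  simp only [inv_eq_one]

/-- The sum over pipe dreams, in terms of the 0-Hecke algebra: `pipeSum x i l w` is the coordinate
at `e_w` of the product of the factors `1 + x_k T_j`, over `k = i, …, i + l - 1` in increasing order
and, for given `k`, over `j = i + l - 1, …, k` in decreasing order. -/
def pipeSum (x : ℕ → S) (i l : ℕ) : Equiv.Perm (Fin n) → S :=
  cellRows (leftGen n S) x i l (Pi.single 1 1)

theorem pipeSum_zero (x : ℕ → S) (i : ℕ) : pipeSum (n := n) x i 0 = Pi.single 1 1 := rfl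

theorem pipeSum_succ (x : ℕ → S) (i l : ℕ) : pipeSum (n := n) x i (l + 1) =
    cellRow (leftGen n S) i (l + 1) (x i) (pipeSum x (i + 1) l) := rfl

/-- Transposition of pipe dreams, for equal parameters. -/
theorem pipeSum_inv (t : S) (i l : ℕ) (w : Equiv.Perm (Fin n)) :
    pipeSum (fun _ => t) i l w⁻¹ = pipeSum (fun _ => t) i l w := by
  have h1 := congrArg (fun F : Module.End S (Equiv.Perm (Fin n) → S) => F (Pi.single 1 1) w)
    (mul_cellRows (J := invOp n S) invOp_mul_leftGen (fun _ => t) i l)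
  simp only [Module.End.mul_apply, invOp_single_one, invOp_apply] at h1
  rw [pipeSum, h1, ← cellRows_apply_eq isZeroHecke_leftGen commute_leftGen_rightGen
    leftGen_single_one]

/-- The recursion for the sums over pipe dreams. -/
theorem pipeSum_swap (x : ℕ → S) {k l : ℕ} (i : Fin (n - 1)) (hk : k ≤ i) (hl : (i : ℕ) < k + l)
    (w : Equiv.Perm (Fin n)) :
    (x i - x (i + 1)) *
        (if w (posSucc i) < w (pos i) then pipeSum x k l (w * simple i) else pipeSum x k l w) =
      (1 - x (i + 1)) * pipeSum x k l w -
        (1 - x i) * pipeSum (x ∘ Equiv.swap (i : ℕ) (i + 1)) k l w := by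
  have h1 := congrArg (fun F : Module.End S (Equiv.Perm (Fin n) → S) => F (Pi.single 1 1) w)
    (isZeroHecke_leftGen.cellRows_swap x hk hl)
  have hc : Commute (cellRows (leftGen n S) x k l) (rightGen n S i) :=
    (commute_cellRows (fun j _ => (commute_leftGen_rightGen j i).symm) x l).symm
  have h2 : (cellRows (leftGen n S) x k l * (1 + leftGen n S i)) (Pi.single 1 1) w =
      if w (posSucc i) < w (pos i) then pipeSum x k l (w * simple i) else pipeSum x k l w := by
    rw [Module.End.mul_apply, LinearMap.add_apply, leftGen_single_one, map_add,
      ← Module.End.mul_apply, ← Module.End.mul_apply, hc.eq, mul_one, Module.End.mul_apply,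
      rightGen_coe]
    change pipeSum x k l w + rightOp S i (pipeSum x k l) w = _
    rw [rightOp_apply]
    split_ifs
    · ring
    · ring
  rw [← h2]
  exact h1

theorem map_pipeSum {S' : Type*} [CommRing S'] (φ : S →+* S') (x : ℕ → S) (i l : ℕ)
    (w : Equiv.Perm (Fin n)) : φ (pipeSum x i l w) = pipeSum (φ ∘ x) i l w := by
  have hcell : ∀ (y : S) (j : ℕ) (f : Equiv.Perm (Fin n) → S),
      φ ∘ cell (leftGen n S) j y f = cell (leftGen n S') j (φ y) (φ ∘ f) := fun y j f => by
    funext w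
    rcases Nat.lt_or_ge j (n - 1) with hj | hj
    · lift j to Fin (n - 1) using hj
      simp only [cell_apply, Function.comp_apply, Pi.add_apply, Pi.smul_apply, smul_eq_mul, map_add,
        map_mul, leftGen_apply]
      split_ifs
      · simp only [map_sub]
      · simp only [map_zero]
    · rw [cell_apply, cell_apply, leftGen_of_le hj, leftGen_of_le hj]
      simp
  have hrow : ∀ (l j : ℕ) (y : S) (f : Equiv.Perm (Fin n) → S),
      φ ∘ cellRow (leftGen n S) j l y f = cellRow (leftGen n S') j l (φ y) (φ ∘ f) := by
    intro l
    induction l with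
    | zero => intro j y f; rfl
    | succ l ih =>
      intro j y f
      rw [cellRow_succ, cellRow_succ, Module.End.mul_apply, Module.End.mul_apply, ih, hcell]
  suffices h : φ ∘ pipeSum x i l = pipeSum (n := n) (φ ∘ x) i l from congrFun h w
  induction l generalizing i with
  | zero =>
    funext w
    rw [pipeSum_zero, pipeSum_zero, Function.comp_apply, Pi.single_apply, Pi.single_apply]
    split_ifs
    · exact map_one φ
    · exact map_zero φ
  | succ l ih => rw [pipeSum_succ, pipeSum_succ, hrow, ih, Function.comp_apply]

end Regular

/-! ### The pipe dream formula for Grothendieck polynomials -/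

section Staircase

variable {n : ℕ} {S : Type*} [CommRing S]

theorem cellRow_succ_left {E : Type*} [Ring E] [Algebra S E] (T : ℕ → E) (i l : ℕ) (x : S) :
    cellRow T i (l + 1) x = cell T (i + l) x * cellRow T i l x := by
  induction l generalizing i with
  | zero => simp [cellRow]
  | succ l ih =>
    rw [cellRow_succ, ih, mul_assoc, ← cellRow_succ, show i + 1 + l = i + (l + 1) by omega]

theorem cell_leftGen_apply (j : Fin (n - 1)) (x : S) (f : Equiv.Perm (Fin n) → S)
    (w : Equiv.Perm (Fin n)) :
    cell (leftGen n S) j x f w =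
      f w + if w⁻¹ (posSucc j) < w⁻¹ (pos j) then x * (f (simple j * w) - f w) else 0 := by
  rw [cell_apply, Pi.add_apply, Pi.smul_apply, leftGen_apply, smul_eq_mul, mul_ite, mul_zero]

theorem cell_leftGen_of_le {j : ℕ} (h : n - 1 ≤ j) (x : S) (f : Equiv.Perm (Fin n) → S) :
    cell (leftGen n S) j x f = f := by
  rw [cell_apply, leftGen_of_le h, LinearMap.zero_apply, smul_zero, add_zero]

theorem eq_simple_apply_iff (j : Fin (n - 1)) (a b : Fin n) : simple j a = b ↔ a = simple j b := by
  have h : ∀ c, simple j (simple j c) = c := fun c => by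
    rw [← Equiv.Perm.mul_apply, simple_mul_self, Equiv.Perm.one_apply]
  exact ⟨fun e => by rw [← e, h], fun e => by rw [e, h]⟩

theorem simple_of_lt {j : Fin (n - 1)} {k : Fin n} (h : (k : ℕ) < j) : simple j k = k :=
  simple_of_ne (fun e => by rw [e] at h; exact absurd h (lt_irrefl _))
    (fun e => by
      have h1 : ((posSucc j : Fin n) : ℕ) = j + 1 := rfl
      omega)

theorem cell_apply_eq_zero {f : Equiv.Perm (Fin n) → S} {k : Fin n}
    (hf : ∀ w : Equiv.Perm (Fin n), w k ≠ k → f w = 0) {j : ℕ} (hj : (k : ℕ) < j) (x : S)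
    (w : Equiv.Perm (Fin n)) (hw : w k ≠ k) : cell (leftGen n S) j x f w = 0 := by
  rcases Nat.lt_or_ge j (n - 1) with h | h
  · lift j to Fin (n - 1) using h
    have h1 : (simple j * w) k ≠ k := by
      rw [Equiv.Perm.mul_apply, Ne, eq_simple_apply_iff, simple_of_lt hj]
      exact hw
    rw [cell_leftGen_apply, hf w hw, hf _ h1, sub_self, mul_zero, ite_self, add_zero]
  · rw [cell_leftGen_of_le h, hf w hw]

theorem cellRow_apply_eq_zero {f : Equiv.Perm (Fin n) → S} {k : Fin n}
    (hf : ∀ w : Equiv.Perm (Fin n), w k ≠ k → f w = 0) {i : ℕ} (hi : (k : ℕ) < i) (l : ℕ) (x : S)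
    (w : Equiv.Perm (Fin n)) (hw : w k ≠ k) : cellRow (leftGen n S) i l x f w = 0 := by
  induction l generalizing w with
  | zero => exact hf w hw
  | succ l ih =>
    rw [cellRow_succ_left, Module.End.mul_apply]
    exact cell_apply_eq_zero ih (by omega) x w hw

/-- The rows from `i` on do not move the values smaller than `i`. -/
theorem pipeSum_eq_zero (x : ℕ → S) {i : ℕ} (l : ℕ) {k : Fin n} (hk : (k : ℕ) < i)
    (w : Equiv.Perm (Fin n)) (hw : w k ≠ k) : pipeSum x i l w = 0 := by
  induction l generalizing i w with
  | zero =>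
    rw [pipeSum_zero, Pi.single_eq_of_ne]
    rintro rfl
    exact hw rfl
  | succ l ih =>
    rw [pipeSum_succ]
    exact cellRow_apply_eq_zero (fun w hw => ih (by omega) w hw) hk _ _ w hw

theorem cellRow_apply_eq_zero_of_lt {f : Equiv.Perm (Fin n) → S} {i : Fin n}
    (hf : ∀ w : Equiv.Perm (Fin n), w i ≠ i → f w = 0) (l : ℕ) (x : S)
    (w : Equiv.Perm (Fin n)) (hw : (i : ℕ) + l < w i) : cellRow (leftGen n S) i l x f w = 0 := by
  induction l generalizing w with
  | zero =>
    refine hf w fun h => ?_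
    rw [h] at hw
    omega
  | succ l ih =>
    have hi := (w i).2
    rw [cellRow_succ_left, Module.End.mul_apply]
    rcases Nat.lt_or_ge ((i : ℕ) + l) (n - 1) with h | h
    · have h1 : ((simple ⟨i + l, h⟩ * w) i : ℕ) = w i := by
        rw [Equiv.Perm.mul_apply, val_simple]
        simp only
        split_ifs <;> omega
      rw [cell_leftGen_apply ⟨i + l, h⟩, ih w (by omega), ih _ (by omega), sub_self, mul_zero,
        ite_self, add_zero]
    · omega

theorem lt_inv_apply_pos {w : Equiv.Perm (Fin n)} {i : Fin n} {j : Fin (n - 1)}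
    (h : ∀ k, k < i → w k = k) (hi : w i = posSucc j) (hij : (i : ℕ) ≤ j) : i < w⁻¹ (pos j) := by
  by_contra hcon
  rcases (not_lt.1 hcon).eq_or_lt with h1 | h1
  · have : pos j = w i := by rw [← h1, apply_inv_apply]
    exact pos_ne_posSucc j (this.trans hi)
  · have h2 := h _ h1
    rw [apply_inv_apply] at h2
    rw [← h2] at h1
    have h3 : (j : ℕ) < i := h1
    omega

/-- Only one choice of cells in a row leads to a permutation that starts with the largest
available value. -/
theorem cellRow_apply_of_anti {f : Equiv.Perm (Fin n) → S} {i : Fin n} {c : S}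
    (hf : ∀ w : Equiv.Perm (Fin n), w i ≠ i → f w = 0)
    (hc : ∀ w : Equiv.Perm (Fin n), (∀ k, k ≤ i → w k = k) →
      (∀ p q, i < p → p < q → w q < w p) → f w = c) (l : ℕ) (x : S) (w : Equiv.Perm (Fin n))
    (h1 : ∀ k, k < i → w k = k) (h2 : ∀ p q, i < p → p < q → w q < w p)
    (h3 : (w i : ℕ) = i + l) : cellRow (leftGen n S) i l x f w = x ^ l * c := by
  induction l generalizing w with
  | zero =>
    rw [pow_zero, one_mul]
    refine hc w (fun k hk => ?_) h2
    rcases hk.eq_or_lt with rfl | hk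
    · exact Fin.ext h3
    · exact h1 k hk
  | succ l ih =>
    have hi := (w i).2
    let j : Fin (n - 1) := ⟨i + l, by omega⟩
    have hj : (j : ℕ) = i + l := rfl
    have e1 : w i = posSucc j := Fin.ext (by rw [h3]; simp only [posSucc, hj]; omega)
    have e1' : w⁻¹ (posSucc j) = i := by rw [← e1, inv_apply_apply]
    have e2 := lt_inv_apply_pos h1 e1 (Nat.le_add_right _ _)
    have e3 : cellRow (leftGen n S) i l x f w = 0 :=
      cellRow_apply_eq_zero_of_lt hf l x w (by omega)
    have hne : ∀ p, i < p → w p ≠ posSucc j := fun p hp e =>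
      hp.ne (w.injective (e1.trans e.symm))
    rw [cellRow_succ_left, Module.End.mul_apply, ← hj, cell_leftGen_apply, e1', if_pos e2, e3,
      zero_add, sub_zero, ih, pow_succ']
    · ring
    · intro k hk
      rw [Equiv.Perm.mul_apply, h1 k hk, simple_of_lt]
      have : (k : ℕ) < i := hk
      omega
    · intro p q hp hpq
      rw [Equiv.Perm.mul_apply, Equiv.Perm.mul_apply, simple_lt_simple_iff]
      · exact h2 p q hp hpq
      · exact fun h => hne p hp h.2
      · exact fun h => hne q (hp.trans hpq) h.1
    · rw [Equiv.Perm.mul_apply, e1, simple_posSucc]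
      rfl

theorem eq_one_of_fix {i : ℕ} (hi : n - 1 ≤ i) (w : Equiv.Perm (Fin n))
    (h : ∀ k : Fin n, (k : ℕ) < i → w k = k) : w = 1 := by
  ext k
  rw [Equiv.Perm.one_apply]
  by_cases hk : (k : ℕ) < i
  · rw [h k hk]
  · by_contra hne
    have hlt : (w k : ℕ) < i := by have := (w k).2; have := k.2; omega
    have := w.injective (h _ hlt)
    exact hne (by rw [this])

theorem pipeSum_of_anti (x : ℕ → S) {i l : ℕ} (hil : i + l = n - 1) (w : Equiv.Perm (Fin n))
    (h1 : ∀ k : Fin n, (k : ℕ) < i → w k = k)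
    (h2 : ∀ p q : Fin n, i ≤ (p : ℕ) → p < q → w q < w p) :
    pipeSum x i l w = ∏ k ∈ Finset.range l, x (i + k) ^ (l - k) := by
  induction l generalizing i w with
  | zero =>
    have hw := eq_one_of_fix hil.ge w h1
    rw [hw, pipeSum_zero, Pi.single_eq_same, Finset.range_zero, Finset.prod_empty]
  | succ l ih =>
    let i' : Fin n := ⟨i, by omega⟩
    have htop : (w i' : ℕ) = i + (l + 1) := by
      let m : Fin n := ⟨n - 1, by omega⟩
      have hm : w (w⁻¹ m) = m := apply_inv_apply w m
      have h3 : i' ≤ w⁻¹ m := by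
        by_contra h
        have h4 : ((w⁻¹ m : Fin n) : ℕ) < i := not_le.1 h
        have h5 := h1 _ h4
        rw [hm] at h5
        rw [← h5] at h4
        have : (m : ℕ) = n - 1 := rfl
        omega
      rcases h3.eq_or_lt with h | h
      · rw [h, hm, hil]
      · have h4 := h2 i' _ le_rfl h
        rw [hm] at h4
        have h5 : n - 1 < (w i' : ℕ) := h4
        have := (w i').2
        omega
    rw [pipeSum_succ, Finset.prod_range_succ', add_zero, tsub_zero, mul_comm]
    refine cellRow_apply_of_anti (i := i')
      (fun w hw => pipeSum_eq_zero x l (Nat.lt_succ_self i) w hw) ?_ (l + 1) (x i) w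
      (fun k hk => h1 k hk) (fun p q hp hpq => h2 p q (le_of_lt hp) hpq) htop
    intro u hu1 hu2
    rw [ih (i := i + 1) (by omega) u (fun k hk => hu1 k (Nat.lt_succ_iff.1 hk))
      (fun p q hp hpq => hu2 p q hp hpq)]
    refine Finset.prod_congr rfl fun k _ => ?_
    rw [show i + 1 + k = i + (k + 1) by omega, show l + 1 - (k + 1) = l - k by omega]

end Staircase

section PipeDreamFormula

open MvPolynomial

variable {n : ℕ}

/-- The variables, indexed by natural numbers. -/
noncomputable def varSeq (n : ℕ) (k : ℕ) : MvPolynomial (Fin n) ℤ :=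
  if h : k < n then X ⟨k, h⟩ else 0

theorem varSeq_coe (k : Fin n) : varSeq n k = X k := dif_pos k.2

theorem rename_varSeq (i : Fin (n - 1)) :
    rename (simple i) ∘ varSeq n = varSeq n ∘ Equiv.swap (i : ℕ) (i + 1) := by
  funext k
  rw [Function.comp_apply, Function.comp_apply]
  rcases Nat.lt_or_ge k n with h | h
  · lift k to Fin n using h
    have : ((simple i k : Fin n) : ℕ) = Equiv.swap (i : ℕ) (i + 1) k := by
      rw [val_simple, Equiv.swap_apply_def]
    rw [varSeq_coe, rename_X, ← this, varSeq_coe]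
  · have := i.2
    rw [Equiv.swap_apply_of_ne_of_ne (by omega) (by omega), varSeq, dif_neg (by omega), map_zero]

theorem isRecursiveFamily_pipeSum (n : ℕ) :
    IsRecursiveFamily dividedDiffBar (∏ k ∈ Finset.range (n - 1), varSeq n k ^ (n - 1 - k))
      (pipeSum (n := n) (varSeq n) 0 (n - 1)) := by
  have key : ∀ (w : Equiv.Perm (Fin n)) (i : Fin (n - 1)),
      dividedDiffBar i (pipeSum (varSeq n) 0 (n - 1) w) =
        if w (posSucc i) < w (pos i) then pipeSum (varSeq n) 0 (n - 1) (w * simple i)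
        else pipeSum (varSeq n) 0 (n - 1) w := by
    intro w i
    apply mul_left_cancel₀ (X_sub_X_ne_zero (R := ℤ) (pos_ne_posSucc i))
    have h1 := pipeSum_swap (varSeq n) (k := 0) (l := n - 1) i (Nat.zero_le _)
      (by have := i.2; omega) w
    have h2 : varSeq n i = X (pos i) := varSeq_coe (pos i)
    have h3 : varSeq n (i + 1) = X (posSucc i) := varSeq_coe (posSucc i)
    have h4 : rename (simple i) (pipeSum (varSeq n) 0 (n - 1) w) =
        pipeSum (varSeq n ∘ Equiv.swap (i : ℕ) (i + 1)) 0 (n - 1) w := by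
      rw [← rename_varSeq]
      exact map_pipeSum (rename (simple i) : MvPolynomial (Fin n) ℤ →ₐ[ℤ] _).toRingHom _ _ _ w
    rw [mul_dividedDiffBar, h4, ← h2, ← h3, h1]
  refine ⟨?_, fun w i h => by rw [key, if_pos h], fun w i h => by rw [key, if_neg h.asymm]⟩
  rw [pipeSum_of_anti _ (zero_add _) _ (fun k hk => absurd hk (Nat.not_lt_zero _))
    (fun p q _ hpq => Fin.rev_lt_rev.2 hpq)]
  simp only [zero_add]

theorem map_dividedDiffBar {R R' : Type*} [CommRing R] [CommRing R'] [IsDomain R'] (φ : R →+* R')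
    (i : Fin (n - 1)) (f : MvPolynomial (Fin n) R) :
    map φ (dividedDiffBar i f) = dividedDiffBar i (map φ f) := by
  apply mul_left_cancel₀ (X_sub_X_ne_zero (R := R') (pos_ne_posSucc i))
  have h := congrArg (map φ) (mul_dividedDiffBar i f)
  simp only [map_mul, map_sub, map_one, map_X, map_rename] at h
  rw [h, mul_dividedDiffBar]

theorem prod_varSeq (n : ℕ) : ∏ k ∈ Finset.range (n - 1), varSeq n k ^ (n - 1 - k) =
    ∏ k : Fin n, X k ^ (n - 1 - (k : ℕ)) := by
  have h1 : ∏ k : Fin n, (X k : MvPolynomial (Fin n) ℤ) ^ (n - 1 - (k : ℕ)) =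
      ∏ k : Fin n, varSeq n k ^ (n - 1 - (k : ℕ)) :=
    Finset.prod_congr rfl fun k _ => by rw [varSeq_coe]
  rw [h1, Fin.prod_univ_eq_prod_range (fun k => varSeq n k ^ (n - 1 - k)) n]
  refine Finset.prod_subset (fun k hk => ?_) (fun k hk hk' => ?_)
  · rw [Finset.mem_range] at hk ⊢
    omega
  · rw [Finset.mem_range] at hk hk'
    rw [show n - 1 - k = 0 by omega, pow_zero]

theorem map_doubleGrothendieckTop (n : ℕ) :
    map (eval fun _ => (0 : ℤ)) (doubleGrothendieckTop n) =
      ∏ k ∈ Finset.range (n - 1), varSeq n k ^ (n - 1 - k) := by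
  rw [prod_varSeq, doubleGrothendieckTop, map_prod, Finset.prod_filter, Fintype.prod_prod_type]
  refine Finset.prod_congr rfl fun i _ => ?_
  have h2 : ∀ j : Fin n, map (eval fun _ => (0 : ℤ))
      (X i + C (X j) - X i * C (X j) : MvPolynomial (Fin n) (MvPolynomial (Fin n) ℤ)) = X i :=
    fun j => by simp
  simp only [h2]
  rw [← Finset.prod_filter, Finset.prod_const]
  congr 1
  have h3 : (Finset.univ.filter fun j : Fin n => (i : ℕ) + 1 + (j + 1) ≤ n) =
      Finset.univ.filter fun j : Fin n => (j : ℕ) < n - 1 - i := by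
    ext j
    simp only [Finset.mem_filter, Finset.mem_univ, true_and]
    omega
  rw [h3, Fin.card_filter_val_lt]
  omega

theorem isRecursiveFamily_grothendieck (n : ℕ) :
    IsRecursiveFamily dividedDiffBar (∏ k ∈ Finset.range (n - 1), varSeq n k ^ (n - 1 - k))
      (grothendieck (n := n)) := by
  have h := isRecursiveFamily_doubleGrothendieck n
  refine ⟨?_, fun w i hw => ?_, fun w i hw => ?_⟩
  · rw [grothendieck, h.initial, map_doubleGrothendieckTop]
  · rw [grothendieck, ← map_dividedDiffBar, h.descent w i hw, grothendieck]
  · rw [grothendieck, ← map_dividedDiffBar, h.ascent w i hw]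

/-- The pipe dream formula of Fomin and Kirillov. -/
theorem grothendieck_eq_pipeSum (w : Equiv.Perm (Fin n)) :
    grothendieck w = pipeSum (varSeq n) 0 (n - 1) w :=
  congrFun ((existsUnique_isRecursiveFamily _ dividedDiffBar_idem
    (fun _ _ h => dividedDiffBar_comm h) (fun _ _ h => dividedDiffBar_braid h)).unique
    (isRecursiveFamily_grothendieck n) (isRecursiveFamily_pipeSum n)) w

end PipeDreamFormula

/-! ### Signs of the coefficients -/

section Signs

open MvPolynomial

variable {n : ℕ}

/-- The sign of a permutation, as an element of a ring. -/
def sgn (S : Type*) [CommRing S] (w : Equiv.Perm (Fin n)) : S := ((Equiv.Perm.sign w : ℤ) : S)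

theorem sgn_one (S : Type*) [CommRing S] : sgn S (1 : Equiv.Perm (Fin n)) = 1 := by
  simp [sgn]

theorem sgn_simple_mul (S : Type*) [CommRing S] (j : Fin (n - 1)) (w : Equiv.Perm (Fin n)) :
    sgn S (simple j * w) = -sgn S w := by
  rw [sgn, Equiv.Perm.sign_mul, simple, Equiv.Perm.sign_swap (pos_ne_posSucc j), sgn]
  push_cast
  ring

theorem sgn_eq (S : Type*) [CommRing S] (w : Equiv.Perm (Fin n)) :
    sgn S w = 1 ∨ sgn S w = -1 := by
  rcases Int.units_eq_one_or (Equiv.Perm.sign w) with h | h <;> simp [sgn, h]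

theorem sgn_mul_cell {S : Type*} [CommRing S] (j : Fin (n - 1)) (x : S)
    (f : Equiv.Perm (Fin n) → S) (w : Equiv.Perm (Fin n)) :
    sgn S w * cell (leftGen n S) j x f w =
      sgn S w * f w + if w⁻¹ (posSucc j) < w⁻¹ (pos j) then
        -x * (sgn S (simple j * w) * f (simple j * w) + sgn S w * f w) else 0 := by
  rw [cell_leftGen_apply, sgn_simple_mul]
  split_ifs <;> ring

theorem sgn_mul_cell_mem {S : Type*} [CommRing S] {K : Subsemiring S} {x : S} (hx : -x ∈ K)
    {f : Equiv.Perm (Fin n) → S} (hf : ∀ w, sgn S w * f w ∈ K) (j : ℕ) (w : Equiv.Perm (Fin n)) :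
    sgn S w * cell (leftGen n S) j x f w ∈ K := by
  rcases Nat.lt_or_ge j (n - 1) with h | h
  · lift j to Fin (n - 1) using h
    rw [sgn_mul_cell]
    refine K.add_mem (hf w) ?_
    split_ifs
    · exact K.mul_mem hx (K.add_mem (hf _) (hf w))
    · exact K.zero_mem
  · rw [cell_leftGen_of_le h]
    exact hf w

theorem sgn_mul_cellRow_mem {S : Type*} [CommRing S] {K : Subsemiring S} {x : S} (hx : -x ∈ K)
    {f : Equiv.Perm (Fin n) → S} (hf : ∀ w, sgn S w * f w ∈ K) (i l : ℕ) (w : Equiv.Perm (Fin n)) :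
    sgn S w * cellRow (leftGen n S) i l x f w ∈ K := by
  induction l generalizing w with
  | zero => exact hf w
  | succ l ih =>
    rw [cellRow_succ_left, Module.End.mul_apply]
    exact sgn_mul_cell_mem hx ih _ w

/-- If the negatives of the parameters lie in a set closed under addition and multiplication, then
so do, up to the sign of the permutation, the sums over pipe dreams. -/
theorem sgn_mul_pipeSum_mem {S : Type*} [CommRing S] {K : Subsemiring S} {x : ℕ → S}
    (hx : ∀ k, -x k ∈ K) (i l : ℕ) (w : Equiv.Perm (Fin n)) :
    sgn S w * pipeSum x i l w ∈ K := by
  induction l generalizing i w with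
  | zero =>
    rw [pipeSum_zero, Pi.single_apply]
    split_ifs with h
    · rw [h, sgn_one, one_mul]
      exact K.one_mem
    · rw [mul_zero]
      exact K.zero_mem
  | succ l ih =>
    rw [pipeSum_succ]
    exact sgn_mul_cellRow_mem (hx i) (fun w => ih _ w) _ _ w

/-- The polynomials whose coefficients in degree `d` have sign `(-1) ^ d`. -/
def alternatingCone (n : ℕ) : Subsemiring (MvPolynomial (Fin n) ℤ) where
  carrier := {p | ∀ m, 0 ≤ (-1) ^ m.degree * coeff m p}
  zero_mem' m := by simp
  one_mem' m := by
    rw [coeff_one]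
    split_ifs with h
    · rw [← h]; simp
    · simp
  add_mem' {p q} hp hq m := by
    rw [coeff_add, mul_add]
    exact add_nonneg (hp m) (hq m)
  mul_mem' {p q} hp hq m := by
    classical
    rw [coeff_mul, Finset.mul_sum]
    refine Finset.sum_nonneg fun a ha => ?_
    rw [← Finset.HasAntidiagonal.mem_antidiagonal.1 ha, map_add, pow_add]
    have := mul_nonneg (hp a.1) (hq a.2)
    linarith

theorem neg_varSeq_mem (k : ℕ) : -varSeq n k ∈ alternatingCone n := by
  rw [varSeq]
  split_ifs with h
  · intro m
    rw [coeff_neg, coeff_X]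
    split_ifs with hm
    · rw [← hm]; simp
    · simp
  · rw [neg_zero]
    exact Subsemiring.zero_mem _

theorem coeff_aeval_neg_X (p : MvPolynomial (Fin n) ℤ) (d : ℕ) :
    (aeval (fun _ => (-Polynomial.X : Polynomial ℤ)) p).coeff d =
      ∑ m ∈ p.support with m.degree = d, (-1) ^ m.degree * coeff m p := by
  rw [aeval_def, eval₂_eq', Polynomial.finsetSum_coeff, Finset.sum_filter]
  refine Finset.sum_congr rfl fun m _ => ?_
  have h : ∏ i, (-Polynomial.X : Polynomial ℤ) ^ m i =
      Polynomial.C ((-1) ^ m.degree) * Polynomial.X ^ m.degree := by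
    rw [Finset.prod_pow_eq_pow_sum, ← Finsupp.degree_eq_sum, neg_pow]
    simp
  rw [h, Polynomial.algebraMap_eq, ← mul_assoc, ← Polynomial.C_mul, Polynomial.coeff_C_mul_X_pow]
  split_ifs with h1 h2 h2
  · ring
  · exact absurd h1.symm h2
  · exact absurd h2.symm h1
  · rfl

theorem natDegree_aeval_neg_X {p : MvPolynomial (Fin n) ℤ} (hp : p ∈ alternatingCone n) :
    (aeval (fun _ => (-Polynomial.X : Polynomial ℤ)) p).natDegree = p.totalDegree := by
  rcases eq_or_ne p 0 with rfl | h0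
  · simp
  apply le_antisymm
  · refine Polynomial.natDegree_le_iff_coeff_eq_zero.2 fun d hd => ?_
    rw [coeff_aeval_neg_X]
    refine Finset.sum_eq_zero fun m hm => ?_
    obtain ⟨h1, h2⟩ := Finset.mem_filter.1 hm
    have h3 := le_totalDegree h1
    have h4 : (m.sum fun _ e => e) = m.degree := rfl
    omega
  · obtain ⟨m, hm, e⟩ := Finset.exists_mem_eq_sup p.support (support_nonempty.2 h0)
      fun m => m.sum fun _ e => e
    have e' : p.totalDegree = m.degree := e
    refine Polynomial.le_natDegree_of_ne_zero (ne_of_gt ?_)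
    rw [coeff_aeval_neg_X]
    refine Finset.sum_pos' (fun m _ => hp m) ⟨m, Finset.mem_filter.2 ⟨hm, e'.symm⟩, ?_⟩
    refine lt_of_le_of_ne (hp m) (Ne.symm (mul_ne_zero ?_ (mem_support_iff.1 hm)))
    exact pow_ne_zero _ (by norm_num)

theorem aeval_grothendieck (w : Equiv.Perm (Fin n)) :
    aeval (fun _ => (-Polynomial.X : Polynomial ℤ)) (grothendieck w) =
      pipeSum (fun _ => (-Polynomial.X : Polynomial ℤ)) 0 (n - 1) w := by
  have h4 := map_pipeSum (aeval fun _ => (-Polynomial.X : Polynomial ℤ)).toRingHom (varSeq n) 0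
    (n - 1) w
  rw [← grothendieck_eq_pipeSum] at h4
  refine Eq.trans h4 ?_
  rw [pipeSum, pipeSum, cellRows_congr]
  intro k _ hk
  have h5 : varSeq n k = X ⟨k, by omega⟩ := dif_pos _
  rw [Function.comp_apply, h5]
  exact aeval_X (fun _ => (-Polynomial.X : Polynomial ℤ)) _

/-- The degree of a Grothendieck polynomial can be computed after setting all variables equal, since
no terms of the same degree cancel. -/
theorem totalDegree_grothendieck (w : Equiv.Perm (Fin n)) :
    (grothendieck w).totalDegree =
      (pipeSum (fun _ => (-Polynomial.X : Polynomial ℤ)) 0 (n - 1) w).natDegree := by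
  have h1 := sgn_mul_pipeSum_mem (neg_varSeq_mem (n := n)) 0 (n - 1) w
  rw [← grothendieck_eq_pipeSum] at h1
  have h2 := natDegree_aeval_neg_X h1
  rw [← aeval_grothendieck]
  rcases sgn_eq (MvPolynomial (Fin n) ℤ) w with h | h
  · rwa [h, one_mul, eq_comm] at h2
  · rwa [h, neg_one_mul, map_neg, Polynomial.natDegree_neg, totalDegree_neg, eq_comm] at h2

theorem totalDegree_grothendieck_inv (w : Equiv.Perm (Fin n)) :
    (grothendieck w⁻¹).totalDegree = (grothendieck w).totalDegree := by
  rw [totalDegree_grothendieck, totalDegree_grothendieck, pipeSum_inv]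

end Signs

/-! ### Pipe dreams with many crossings -/

section LowerBound

open Polynomial

variable {n : ℕ}

/-- `f` has, at `w` and up to the sign of `w`, a positive coefficient in degree `d`. -/
def HasTerm (f : Equiv.Perm (Fin n) → ℤ[X]) (w : Equiv.Perm (Fin n)) (d : ℕ) : Prop :=
  0 < (sgn ℤ[X] w * f w).coeff d

/-- Up to the signs of the permutations, all coefficients of `f` are nonnegative. -/
def SignedNonneg (f : Equiv.Perm (Fin n) → ℤ[X]) : Prop :=
  ∀ w d, 0 ≤ (sgn ℤ[X] w * f w).coeff d

theorem coeff_sgn_mul_cell (j : Fin (n - 1)) (f : Equiv.Perm (Fin n) → ℤ[X])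
    {w : Equiv.Perm (Fin n)} (hw : w⁻¹ (posSucc j) < w⁻¹ (pos j)) (d : ℕ) :
    (sgn ℤ[X] w * cell (leftGen n ℤ[X]) j (-X : ℤ[X]) f w).coeff (d + 1) =
      (sgn ℤ[X] w * f w).coeff (d + 1) + ((sgn ℤ[X] (simple j * w) * f (simple j * w)).coeff d +
        (sgn ℤ[X] w * f w).coeff d) := by
  rw [sgn_mul_cell, if_pos hw, neg_neg, coeff_add, coeff_X_mul, coeff_add]

theorem HasTerm.cell_omit {f : Equiv.Perm (Fin n) → ℤ[X]} (hf : SignedNonneg f)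
    {w : Equiv.Perm (Fin n)} {d : ℕ} (h : HasTerm f w d) (j : Fin (n - 1)) :
    HasTerm (cell (leftGen n ℤ[X]) j (-X : ℤ[X]) f) w d := by
  unfold HasTerm at h ⊢
  rw [sgn_mul_cell, neg_neg, coeff_add]
  refine add_pos_of_pos_of_nonneg h ?_
  split_ifs
  · cases d with
    | zero => rw [coeff_X_mul_zero]
    | succ d =>
      rw [coeff_X_mul, coeff_add]
      exact add_nonneg (hf _ d) (hf _ d)
  · rw [coeff_zero]

theorem HasTerm.cell_use {f : Equiv.Perm (Fin n) → ℤ[X]} (hf : SignedNonneg f)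
    {w : Equiv.Perm (Fin n)} {d : ℕ} (h : HasTerm f w d) {j : Fin (n - 1)}
    (hw : w⁻¹ (posSucc j) < w⁻¹ (pos j)) :
    HasTerm (cell (leftGen n ℤ[X]) j (-X : ℤ[X]) f) w (d + 1) := by
  unfold HasTerm at h ⊢
  rw [coeff_sgn_mul_cell j f hw]
  have h1 := hf w (d + 1)
  have h2 := hf (simple j * w) d
  linarith

theorem HasTerm.cell_swap {f : Equiv.Perm (Fin n) → ℤ[X]} (hf : SignedNonneg f)
    {w : Equiv.Perm (Fin n)} {d : ℕ} {j : Fin (n - 1)} (h : HasTerm f (simple j * w) d)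
    (hw : w⁻¹ (posSucc j) < w⁻¹ (pos j)) :
    HasTerm (cell (leftGen n ℤ[X]) j (-X : ℤ[X]) f) w (d + 1) := by
  unfold HasTerm at h ⊢
  rw [coeff_sgn_mul_cell j f hw]
  have h1 := hf w (d + 1)
  have h2 := hf w d
  linarith

/-- The polynomials over `ℤ` with nonnegative coefficients. -/
def nonnegCone : Subsemiring ℤ[X] where
  carrier := {p | ∀ d, 0 ≤ p.coeff d}
  zero_mem' d := by rw [coeff_zero]
  one_mem' d := by rw [coeff_one]; split_ifs <;> norm_num
  add_mem' {p q} hp hq d := by rw [coeff_add]; exact add_nonneg (hp d) (hq d)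
  mul_mem' {p q} hp hq d := by
    rw [coeff_mul]
    exact Finset.sum_nonneg fun a _ => mul_nonneg (hp _) (hq _)

theorem neg_neg_X_mem : -(-X : ℤ[X]) ∈ nonnegCone := fun d => by
  rw [neg_neg, coeff_X]
  split_ifs <;> norm_num

theorem SignedNonneg.cellRow {f : Equiv.Perm (Fin n) → ℤ[X]} (hf : SignedNonneg f) (i l : ℕ) :
    SignedNonneg (cellRow (leftGen n ℤ[X]) i l (-X : ℤ[X]) f) :=
  fun w => sgn_mul_cellRow_mem (K := nonnegCone) neg_neg_X_mem hf i l w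

theorem signedNonneg_pipeSum (i l : ℕ) :
    SignedNonneg (pipeSum (n := n) (fun _ => (-X : ℤ[X])) i l) :=
  fun w => sgn_mul_pipeSum_mem (K := nonnegCone) (fun _ => neg_neg_X_mem) i l w

/-- The labels `lev` decrease strictly towards the southeast, on the dots of `w` in rows below
`i`. -/
def IsLabelling (w : Equiv.Perm (Fin n)) (i : Fin n) (lev : Fin n → ℕ) : Prop :=
  ∀ p q, i < p → p < q → w p < w q → lev q < lev p

section Row

variable {f : Equiv.Perm (Fin n) → ℤ[X]} {i : Fin n} {lev : Fin n → ℕ} {K : ℕ}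

/-- If the value in row `i` is `i + l`, one can use the first `l` cells of the row, lowering that
value at each step. -/
theorem exists_hasTerm_cellRow_of_eq (hf : SignedNonneg f)
    (hbase : ∀ u : Equiv.Perm (Fin n), (∀ k, k ≤ i → u k = k) → IsLabelling u i lev →
      ∃ d, K ≤ d ∧ HasTerm f u d) (l : ℕ) (w : Equiv.Perm (Fin n)) (h1 : ∀ k, k < i → w k = k)
    (h2 : IsLabelling w i lev) (h3 : (w i : ℕ) = i + l) :
    ∃ d, K + l ≤ d ∧ HasTerm (cellRow (leftGen n ℤ[X]) i l (-X : ℤ[X]) f) w d := by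
  induction l generalizing w with
  | zero =>
    refine hbase w (fun k hk => ?_) h2
    rcases hk.eq_or_lt with rfl | hk
    · exact Fin.ext h3
    · exact h1 k hk
  | succ l ih =>
    have hi := (w i).2
    let j : Fin (n - 1) := ⟨i + l, by omega⟩
    have hj : (j : ℕ) = i + l := rfl
    have e1 : w i = posSucc j := Fin.ext (by rw [h3]; simp only [posSucc, hj]; omega)
    have e1' : w⁻¹ (posSucc j) = i := by rw [← e1, inv_apply_apply]
    have e2 := lt_inv_apply_pos h1 e1 (Nat.le_add_right _ _)
    have hne : ∀ p, i < p → w p ≠ posSucc j := fun p hp e =>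
      hp.ne (w.injective (e1.trans e.symm))
    obtain ⟨d, hd, ht⟩ := ih (simple j * w)
      (fun k hk => by
        rw [Equiv.Perm.mul_apply, h1 k hk, simple_of_lt]
        have : (k : ℕ) < i := hk
        omega)
      (fun p q hp hpq h => by
        rw [Equiv.Perm.mul_apply, Equiv.Perm.mul_apply, simple_lt_simple_iff
          (fun h => hne q (hp.trans hpq) h.2) (fun h => hne p hp h.1)] at h
        exact h2 p q hp hpq h)
      (by rw [Equiv.Perm.mul_apply, e1, simple_posSucc]; rfl)
    refine ⟨d + 1, by omega, ?_⟩
    rw [cellRow_succ_left, Module.End.mul_apply]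
    exact HasTerm.cell_swap (j := j) (hf.cellRow i l) ht (by rw [e1']; exact e2)

/-- Reading a row from left to right one follows a current dot `c`, whose value decreases by one at
each step.  Let `d` be the dot with the next smaller value.  If `d` has a larger label than `c`, its
cell is not used, and `d` becomes the current dot; if the labels agree, the cell is used without
effect, and `d` becomes the current dot; if the label of `d` is smaller, the cell is used and
exchanges the values of `c` and `d`.  In this way a cell remains unused only if the label of the
current dot increases. -/
theorem exists_hasTerm_cellRow_of_lt (hf : SignedNonneg f)
    (hbase : ∀ u : Equiv.Perm (Fin n), (∀ k, k ≤ i → u k = k) → IsLabelling u i lev →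
      ∃ d, K ≤ d ∧ HasTerm f u d) (l : ℕ) (w : Equiv.Perm (Fin n)) (h1 : ∀ k, k < i → w k = k)
    (h2 : IsLabelling w i lev) (h3 : ∀ p, i < p → w i < w p → lev p < lev i) (c : Fin n)
    (hc : (w c : ℕ) = i + l) (hic : w i < w c) :
    ∃ d, K + l + lev c ≤ d + lev i ∧ HasTerm (cellRow (leftGen n ℤ[X]) i l (-X : ℤ[X]) f) w d := by
  have hgt : ∀ p, i ≤ w p → i ≤ p := fun p hp => by
    by_contra h
    rw [h1 p (not_le.1 h)] at hp
    exact h hp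
  have hle : i ≤ w i := by
    by_contra h
    have := w.injective (h1 _ (not_le.1 h))
    exact h this.ge
  induction l generalizing w c with
  | zero =>
    have h4 : (i : ℕ) ≤ w i := hle
    have h5 : (w i : ℕ) < w c := hic
    omega
  | succ l ih =>
    have hwc := (w c).2
    obtain ⟨j, hj⟩ : ∃ j : Fin (n - 1), (j : ℕ) = i + l := ⟨⟨i + l, by omega⟩, rfl⟩
    have hij : i ≤ pos j := Fin.le_def.2 (by simp [pos, hj])
    have e1 : w c = posSucc j := Fin.ext (by rw [hc]; simp only [posSucc, hj]; omega)
    have e1' : w⁻¹ (posSucc j) = c := by rw [← e1, inv_apply_apply]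
    have hic' : i < c := lt_of_le_of_ne (hgt c (hle.trans hic.le)) fun e => by
      rw [e] at hic
      exact absurd hic (lt_irrefl _)
    have hlev := h3 c hic' hic
    rw [cellRow_succ_left, Module.End.mul_apply, ← hj]
    rcases eq_or_ne (w i) (pos j) with h4 | h4
    · obtain ⟨d, hd, ht⟩ := exists_hasTerm_cellRow_of_eq hf hbase l w h1 h2 (by rw [h4]; exact hj)
      exact ⟨d, by omega, ht.cell_omit (hf.cellRow i l) j⟩
    obtain ⟨d, hd⟩ : ∃ d, w d = pos j := ⟨w⁻¹ (pos j), apply_inv_apply _ _⟩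
    have hd' : w⁻¹ (pos j) = d := by rw [← hd, inv_apply_apply]
    have hid : i < d := lt_of_le_of_ne (hgt d (by rw [hd]; exact hij)) fun e => h4 (by rw [e, hd])
    have hwid : w i < w d := by
      rw [hd]
      refine lt_of_le_of_ne ?_ h4
      rw [e1] at hic
      exact Nat.lt_succ_iff.1 hic
    have hdc : w d < w c := by rw [hd, e1]; exact pos_lt_posSucc j
    have hcd : lev d ≤ lev c → c < d := fun h => by
      by_contra h5
      have h6 : d < c := lt_of_le_of_ne (not_lt.1 h5) fun e => hdc.ne (by rw [e])
      have := h2 d c hid h6 hdc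
      omega
    have hwd : (w d : ℕ) = i + l := by rw [hd]; exact hj
    rcases lt_trichotomy (lev d) (lev c) with h5 | h5 | h5
    · have hcd := hcd h5.le
      have hsc : (simple j * w) c = pos j := by rw [Equiv.Perm.mul_apply, e1, simple_posSucc]
      have hsi : (simple j * w) i = w i := by
        rw [Equiv.Perm.mul_apply]
        exact simple_of_ne h4 fun e => hic.ne (e.trans e1.symm)
      have hs1 : ∀ k, k < i → (simple j * w) k = k := fun k hk => by
        rw [Equiv.Perm.mul_apply, h1 k hk, simple_of_lt]
        have : (k : ℕ) < i := hk
        omega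
      have hs2 : IsLabelling (simple j * w) i lev := fun p q hp hpq h => by
        by_cases h6 : p = c ∧ q = d
        · rw [h6.1, h6.2]; exact h5
        · rw [Equiv.Perm.mul_apply, Equiv.Perm.mul_apply, simple_lt_simple_iff] at h
          · exact h2 p q hp hpq h
          · rintro ⟨h7, h8⟩
            obtain rfl := w.injective (h7.trans hd.symm)
            obtain rfl := w.injective (h8.trans e1.symm)
            exact absurd hpq hcd.asymm
          · rintro ⟨h7, h8⟩
            exact h6 ⟨w.injective (h7.trans e1.symm), w.injective (h8.trans hd.symm)⟩
      have hs3 : ∀ p, i < p → (simple j * w) i < (simple j * w) p → lev p < lev i := by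
        intro p hp h
        refine h3 p hp ?_
        rw [hsi, Equiv.Perm.mul_apply] at h
        by_cases h6 : w p = pos j
        · rw [h6, ← hd]; exact hwid
        by_cases h7 : w p = posSucc j
        · rw [h7, ← e1]; exact hic
        · rwa [simple_of_ne h6 h7] at h
      obtain ⟨e, he, ht⟩ := ih (simple j * w) hs1 hs2 hs3 c (by rw [hsc]; exact hj)
        (by rw [hsi, hsc, ← hd]; exact hwid)
        (fun p hp => by
          by_contra h
          rw [hs1 p (not_le.1 h)] at hp
          exact h hp)
        (by rw [hsi]; exact hle)
      exact ⟨e + 1, by omega, ht.cell_swap (hf.cellRow i l) (by rw [e1', hd']; exact hcd)⟩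
    · have hcd := hcd h5.le
      obtain ⟨e, he, ht⟩ := ih w h1 h2 h3 d hwd hwid hgt hle
      exact ⟨e + 1, by omega, ht.cell_use (hf.cellRow i l) (by rw [e1', hd']; exact hcd)⟩
    · obtain ⟨e, he, ht⟩ := ih w h1 h2 h3 d hwd hwid hgt hle
      exact ⟨e, by omega, ht.cell_omit (hf.cellRow i l) j⟩

end Row

/-- One can choose at least `rajCode w i` cells in each row `i`. -/
theorem exists_hasTerm_pipeSum {i l : ℕ} (hil : i + l = n - 1) (w : Equiv.Perm (Fin n))
    (h1 : ∀ k : Fin n, (k : ℕ) < i → w k = k) :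
    ∃ d, ∑ k with i ≤ ((k : Fin n) : ℕ), rajCode w k ≤ d ∧ HasTerm (pipeSum (fun _ => (-X : ℤ[X])) i l) w d := by
  induction l generalizing i w with
  | zero =>
    refine ⟨0, le_of_eq (Finset.sum_eq_zero fun k hk => ?_), ?_⟩
    · have h2 := (Finset.mem_filter.1 hk).2
      have h3 := rajCode_add w k
      have h4 := one_le_lisFrom w k
      omega
    · have hw := eq_one_of_fix hil.ge w h1
      rw [HasTerm, hw, pipeSum_zero, sgn_one, Pi.single_eq_same, one_mul, coeff_one_zero]
      exact one_pos
  | succ l ih =>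
    let i' : Fin n := ⟨i, by omega⟩
    have hi' : (i' : ℕ) = i := rfl
    let K := ∑ k with i + 1 ≤ ((k : Fin n) : ℕ), rajCode w k
    have hsum : ∑ k with i ≤ ((k : Fin n) : ℕ), rajCode w k = rajCode w i' + K := by
      have h2 : (Finset.univ.filter fun k : Fin n => i ≤ (k : ℕ)) =
          insert i' (Finset.univ.filter fun k : Fin n => i + 1 ≤ (k : ℕ)) := by
        ext k
        simp only [Finset.mem_filter, Finset.mem_univ, true_and, Finset.mem_insert, Fin.ext_iff, hi']
        omega
      rw [h2, Finset.sum_insert (by simp [hi'])]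
    have hf := signedNonneg_pipeSum (n := n) (i + 1) l
    have hbase : ∀ u : Equiv.Perm (Fin n), (∀ k, k ≤ i' → u k = k) →
        IsLabelling u i' (lisFrom w) →
        ∃ d, K ≤ d ∧ HasTerm (pipeSum (fun _ => (-X : ℤ[X])) (i + 1) l) u d := by
      intro u hu1 hu2
      obtain ⟨d, hd, ht⟩ := ih (i := i + 1) (by omega) u
        (fun k hk => hu1 k (Nat.lt_succ_iff.1 hk))
      refine ⟨d, le_trans (Finset.sum_le_sum fun k hk => ?_) hd, ht⟩
      have hk : i' < k := (Finset.mem_filter.1 hk).2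
      have h2 := lisFrom_le (w := u) (k := k) (l := lisFrom w) (fun p _ => one_le_lisFrom w p)
        (fun p q hp hpq h => hu2 p q (hk.trans_le hp) hpq h)
      have h3 := rajCode_add w k
      have h4 := rajCode_add u k
      omega
    have hlab : IsLabelling w i' (lisFrom w) := fun p q _ hpq h => lisFrom_lt hpq h
    have hraj := rajCode_add w i'
    have hone := one_le_lisFrom w i'
    rw [hsum]
    by_cases htop : (w i' : ℕ) = i + (l + 1)
    · obtain ⟨d, hd, ht⟩ := exists_hasTerm_cellRow_of_eq hf hbase (l + 1) w (fun k hk => h1 k hk)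
        hlab htop
      exact ⟨d, by omega, ht⟩
    · obtain ⟨c, hc⟩ : ∃ c, w c = ⟨i + (l + 1), by omega⟩ := ⟨_, apply_inv_apply w _⟩
      have hc' : (w c : ℕ) = i' + (l + 1) := by rw [hc]
      have hic : w i' < w c := Fin.lt_def.2 (by have := (w i').2; omega)
      obtain ⟨d, hd, ht⟩ := exists_hasTerm_cellRow_of_lt hf hbase (l + 1) w (fun k hk => h1 k hk)
        hlab (fun p hp h => lisFrom_lt hp h) c hc' hic
      have := one_le_lisFrom w c
      exact ⟨d, by omega, ht⟩

theorem exists_coeff_ne_zero (w : Equiv.Perm (Fin n)) :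
    ∃ d, raj w ≤ d ∧ (pipeSum (fun _ => (-X : ℤ[X])) 0 (n - 1) w).coeff d ≠ 0 := by
  obtain ⟨d, hd, ht⟩ := exists_hasTerm_pipeSum (zero_add (n - 1)) w
    (fun k hk => absurd hk (Nat.not_lt_zero _))
  have h1 : ∑ k with 0 ≤ ((k : Fin n) : ℕ), rajCode w k = raj w := by
    simp only [Nat.zero_le, Finset.filter_true]
    rfl
  refine ⟨d, h1 ▸ hd, fun h => ?_⟩
  have ht' : 0 < (sgn ℤ[X] w * pipeSum (fun _ => (-X : ℤ[X])) 0 (n - 1) w).coeff d := ht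
  rcases sgn_eq ℤ[X] w with h2 | h2
  · rw [h2, one_mul, h] at ht'
    exact lt_irrefl _ ht'
  · rw [h2, neg_one_mul, coeff_neg, h, neg_zero] at ht'
    exact lt_irrefl _ ht'

theorem raj_le_totalDegree (w : Equiv.Perm (Fin n)) : raj w ≤ (grothendieck w).totalDegree := by
  obtain ⟨d, hd, h⟩ := exists_coeff_ne_zero w
  rw [totalDegree_grothendieck]
  exact hd.trans (le_natDegree_of_ne_zero h)

theorem grothendieck_ne_zero (w : Equiv.Perm (Fin n)) : grothendieck w ≠ 0 := by
  obtain ⟨d, -, h⟩ := exists_coeff_ne_zero w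
  rw [← aeval_grothendieck] at h
  intro h0
  rw [h0, map_zero, coeff_zero] at h
  exact h rfl

end LowerBound

/-! ### Moving up in both weak orders -/

section UpwardMoves

variable {n : ℕ}

theorem lisFrom_mul_simple_le {w : Equiv.Perm (Fin n)} {i : Fin (n - 1)}
    (hi : w (pos i) < w (posSucc i)) (k : Fin n) :
    lisFrom (w * simple i) k ≤ lisFrom w (simple i k) := by
  refine lisFrom_le (l := fun p => lisFrom w (simple i p)) (fun p _ => one_le_lisFrom _ _) ?_
  intro p q _ hpq h
  refine lisFrom_lt ?_ h
  rw [simple_lt_simple_iff]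
  · exact hpq
  · rintro ⟨rfl, rfl⟩
    rw [Equiv.Perm.mul_apply, Equiv.Perm.mul_apply, simple_pos, simple_posSucc] at h
    exact absurd h hi.asymm
  · rintro ⟨rfl, rfl⟩
    exact absurd hpq (pos_lt_posSucc i).asymm

/-- Exchanging the entries `a < b` of an ascent does not change the Rajchgot index if `b` is
not needed for a longest increasing subsequence starting at `a`. -/
theorem raj_mul_simple_le {w : Equiv.Perm (Fin n)} {i : Fin (n - 1)}
    (hi : w (pos i) < w (posSucc i)) {x : Fin n} (hx : posSucc i < x) (hwx : w (pos i) < w x)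
    (hlev : lisFrom w (posSucc i) ≤ lisFrom w x) : raj (w * simple i) ≤ raj w := by
  have hinv : ∀ p, (w * simple i) (simple i p) = w p := fun p => by
    rw [← Equiv.Perm.mul_apply, mul_simple_simple]
  have hfix : ∀ p, x ≤ p → (w * simple i) p = w p := fun p hp => by
    rw [Equiv.Perm.mul_apply, simple_of_ne ((pos_lt_posSucc i).trans (hx.trans_le hp)).ne'
      (hx.trans_le hp).ne']
  have key : ∀ k, lisFrom w k ≤ lisFrom (w * simple i) (simple i k) := fun k => by
    refine lisFrom_le (l := fun p => lisFrom (w * simple i) (simple i p))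
      (fun p _ => one_le_lisFrom _ _) ?_
    intro p q _ hpq h
    by_cases hpi : p = pos i ∧ q = posSucc i
    · obtain ⟨rfl, rfl⟩ := hpi
      rw [simple_pos, simple_posSucc]
      have h1 := lisFrom_mul_simple_le hi (pos i)
      rw [simple_pos] at h1
      have h2 : lisFrom w x ≤ lisFrom (w * simple i) x :=
        lisFrom_le (fun p _ => one_le_lisFrom _ _) fun p q hp hpq h =>
          lisFrom_lt hpq (by rwa [hfix p hp, hfix q (hp.trans hpq.le)])
      have h3 : lisFrom (w * simple i) x < lisFrom (w * simple i) (posSucc i) :=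
        lisFrom_lt hx (by rw [hfix x le_rfl, Equiv.Perm.mul_apply, simple_posSucc]; exact hwx)
      omega
    · refine lisFrom_lt ?_ (by rwa [hinv, hinv])
      rw [simple_lt_simple_iff hpi]
      · exact hpq
      · rintro ⟨rfl, rfl⟩
        exact absurd hpq (pos_lt_posSucc i).asymm
  have h1 : ∑ k, lisFrom w k ≤ ∑ k, lisFrom (w * simple i) k := by
    refine (Finset.sum_le_sum fun k _ => key k).trans_eq ?_
    exact Equiv.sum_comp (simple i) (lisFrom (w * simple i))
  have h2 := raj_add w
  have h3 := raj_add (w * simple i)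
  omega

/-- `w` avoids the pattern `132`; such permutations are called dominant. -/
def Avoids132 (w : Equiv.Perm (Fin n)) : Prop :=
  ∀ p q r, p < q → q < r → w p < w r → ¬ w r < w q

/-- An ascent of `w` whose larger entry is not needed for a longest increasing subsequence starting
at the smaller one. -/
def HasRedundantAscent (w : Equiv.Perm (Fin n)) : Prop :=
  ∃ i : Fin (n - 1), w (pos i) < w (posSucc i) ∧
    ∃ x, posSucc i < x ∧ w (pos i) < w x ∧ lisFrom w (posSucc i) ≤ lisFrom w x

theorem hasRedundantAscent_of_not_avoids132 {w : Equiv.Perm (Fin n)} (h : ¬ Avoids132 w) :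
    HasRedundantAscent w ∨ HasRedundantAscent w⁻¹ := by
  classical
  -- the last position `o` at which a pattern `132` starts
  let s : Finset (Fin n) :=
    Finset.univ.filter fun p => ∃ q r, p < q ∧ q < r ∧ w p < w r ∧ w r < w q
  have hs : ∀ p, p ∈ s ↔ ∃ q r, p < q ∧ q < r ∧ w p < w r ∧ w r < w q := fun p => by simp [s]
  have hne : s.Nonempty := by
    simp only [Avoids132, not_forall, not_not] at h
    obtain ⟨p, q, r, h1, h2, h3, h4⟩ := h
    exact ⟨p, (hs p).2 ⟨q, r, h1, h2, h3, h4⟩⟩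
  have hos := s.max'_mem hne
  have homax := s.le_max'
  set o := s.max' hne
  obtain ⟨q, r, hoq, hqr, hor, hrq⟩ := (hs o).1 hos
  obtain ⟨j, hj, -⟩ := exists_pos_posSucc (p := o) (q := ⟨o + 1, by omega⟩) rfl
  have hRbad : posSucc j ∉ s := fun h => by
    have : posSucc j ≤ o := homax _ h
    rw [← hj] at this
    exact absurd this (not_le.2 (pos_lt_posSucc j))
  rw [hs] at hRbad
  push Not at hRbad
  have hge : ∀ p, o < p → posSucc j ≤ p := fun p hp => by
    rw [← hj] at hp
    exact hp
  have hasc : w o < w (posSucc j) := by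
    by_contra hcon
    have h1 : posSucc j < q := lt_of_le_of_ne (hge q hoq) fun e => by
      rw [e] at hcon
      exact hcon (hor.trans hrq)
    exact absurd hrq (not_lt.2 (hRbad q r h1 hqr ((not_lt.1 hcon).trans_lt hor)))
  by_cases hX : ∃ x, posSucc j < x ∧ w o < w x ∧ lisFrom w (posSucc j) ≤ lisFrom w x
  · left
    exact ⟨j, by rwa [hj], by rwa [hj]⟩
  push Not at hX
  right
  -- among the entries right of position `o + 1` with values between those at `o` and `o + 1`, the
  -- one with the smallest value, and the entry whose value is one less
  let t : Finset (Fin n) := Finset.univ.filter fun v => posSucc j < v ∧ w o < w v ∧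
    w v < w (posSucc j)
  have ht : ∀ v, v ∈ t ↔ posSucc j < v ∧ w o < w v ∧ w v < w (posSucc j) := fun v => by simp [t]
  have hrt : r ∈ t := by
    have h1 := (hge q hoq).trans_lt hqr
    refine (ht r).2 ⟨h1, hor, ?_⟩
    by_contra hcon
    have h2 : w (posSucc j) < w r :=
      lt_of_le_of_ne (not_lt.1 hcon) fun e => h1.ne (w.injective e)
    have h3 : posSucc j < q := lt_of_le_of_ne (hge q hoq) fun e => by
      rw [e] at h2
      exact absurd h2 hrq.asymm
    exact absurd hrq (not_lt.2 (hRbad q r h3 hqr h2))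
  obtain ⟨v, hv, hvmin⟩ := t.exists_min_image w ⟨r, hrt⟩
  obtain ⟨hv1, hv2, hv3⟩ := (ht v).1 hv
  have hv2' : (w o : ℕ) < w v := hv2
  have hwv := (w v).2
  obtain ⟨i, hi1, hi2⟩ := exists_pos_posSucc (p := ⟨w v - 1, by omega⟩) (q := w v)
    (by simp only; omega)
  have hlt : pos i < w v := by rw [← hi2]; exact pos_lt_posSucc i
  have hle : w o ≤ pos i := by
    rw [hi1]
    exact Fin.le_def.2 (by simp only; omega)
  have hy : w⁻¹ (pos i) ≤ o := by
    by_contra hcon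
    have h1 := hge _ (not_le.1 hcon)
    have h2 : posSucc j < w⁻¹ (pos i) := lt_of_le_of_ne h1 fun e => by
      have h3 : w (posSucc j) = pos i := by rw [e, apply_inv_apply]
      exact absurd (h3 ▸ hv3) hlt.asymm
    have h4 : w o < w (w⁻¹ (pos i)) := by
      rw [apply_inv_apply]
      refine lt_of_le_of_ne hle fun e => ?_
      rw [← e, inv_apply_apply] at hcon
      exact hcon le_rfl
    have h5 := hvmin _ ((ht _).2 ⟨h2, h4, by rw [apply_inv_apply]; exact hlt.trans hv3⟩)
    rw [apply_inv_apply] at h5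
    exact absurd hlt (not_lt.2 h5)
  have hoR : o < posSucc j := by rw [← hj]; exact pos_lt_posSucc j
  refine ⟨i, ?_, w (posSucc j), by rw [hi2]; exact hv3, ?_, ?_⟩
  · rw [hi2, inv_apply_apply]
    exact hy.trans_lt (hoR.trans hv1)
  · rw [inv_apply_apply]
    exact hy.trans_lt hoR
  · rw [hi2, lisFrom_inv, lisFrom_inv]
    exact (hX v hv1 hv2).le

end UpwardMoves

/-! ### Dominant permutations -/

section Dominant

open MvPolynomial

variable {n : ℕ}

/-- The Lehmer code. -/
def code (w : Equiv.Perm (Fin n)) (k : Fin n) : ℕ :=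
  (Finset.univ.filter fun q => k < q ∧ w q < w k).card

theorem code_le_rajCode (w : Equiv.Perm (Fin n)) (k : Fin n) : code w k ≤ rajCode w k := by
  obtain ⟨S, h1, h2, h3, e⟩ := exists_card_eq_lisFrom w k
  have hd : Disjoint S (Finset.univ.filter fun q => k < q ∧ w q < w k) := by
    rw [Finset.disjoint_left]
    intro a ha ha'
    obtain ⟨h4, h5⟩ := (Finset.mem_filter.1 ha').2
    exact absurd h5 (h3 k h2 a ha h4).asymm
  have hsub : S ∪ (Finset.univ.filter fun q => k < q ∧ w q < w k) ⊆ Finset.Ici k := by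
    refine Finset.union_subset (fun a ha => Finset.mem_Ici.2 (h1 a ha)) fun a ha => ?_
    exact Finset.mem_Ici.2 (Finset.mem_filter.1 ha).2.1.le
  have h4 := Finset.card_le_card hsub
  rw [Finset.card_union_of_disjoint hd, Fin.card_Ici, e] at h4
  have h5 := rajCode_add w k
  rw [code]
  omega

theorem code_revPerm (k : Fin n) : code Fin.revPerm k = n - 1 - k := by
  have h : (Finset.univ.filter fun q : Fin n => k < q ∧ Fin.revPerm q < Fin.revPerm k) =
      Finset.Ioi k := by
    ext q
    simp
  rw [code, h, Fin.card_Ioi]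

theorem lt_of_descents {w : Equiv.Perm (Fin n)} {i : Fin (n - 1)}
    (h : ∀ j, j < i → ¬ w (pos j) < w (posSucc j)) {p : Fin n} (hp : p < pos i) :
    w (pos i) < w p := by
  obtain ⟨d, hd⟩ := Nat.exists_eq_add_of_lt (show (p : ℕ) < i from hp)
  induction d generalizing p with
  | zero =>
    obtain ⟨j, h1, h2⟩ := exists_pos_posSucc (p := p) (q := pos i) hd
    have h3 := h j (by rw [Fin.lt_def]; have : (p : ℕ) = j := by rw [← h1]; rfl
                       omega)
    rw [h1, h2] at h3
    exact lt_of_le_of_ne (not_lt.1 h3) fun e => hp.ne (w.injective e.symm)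
  | succ d ih =>
    have hi := i.2
    obtain ⟨j, h1, h2⟩ := exists_pos_posSucc (p := p) (q := ⟨p + 1, by omega⟩) rfl
    have h3 := h j (by rw [Fin.lt_def]; have : (p : ℕ) = j := by rw [← h1]; rfl
                       omega)
    have h4 := ih (p := posSucc j) (by rw [h2, Fin.lt_def]; simp only [pos]; omega)
      (by rw [h2]; simp only; omega)
    rw [h1] at h3
    exact h4.trans_le (not_lt.1 h3)

section FirstAscent

variable {w : Equiv.Perm (Fin n)} {i : Fin (n - 1)}

theorem avoids132_mul_simple (hw : Avoids132 w) (hfirst : ∀ j, j < i → ¬ w (pos j) < w (posSucc j))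
    (hi : w (pos i) < w (posSucc i)) : Avoids132 (w * simple i) := by
  intro p q r hpq hqr hpr hrq
  have hne : ∀ {a b : Fin n}, a < b → ¬ (a = posSucc i ∧ b = pos i) := fun {a b} hab h => by
    rw [h.1, h.2] at hab
    exact absurd hab (pos_lt_posSucc i).asymm
  have h1 : ¬ (p = pos i ∧ q = posSucc i) := by
    rintro ⟨rfl, rfl⟩
    have := hpr.trans hrq
    rw [Equiv.Perm.mul_apply, Equiv.Perm.mul_apply, simple_pos, simple_posSucc] at this
    exact absurd this hi.asymm
  have h2 : ¬ (q = pos i ∧ r = posSucc i) := by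
    rintro ⟨rfl, rfl⟩
    rw [Equiv.Perm.mul_apply, Equiv.Perm.mul_apply, simple_posSucc,
      simple_of_ne hpq.ne (hpq.trans (pos_lt_posSucc i)).ne] at hpr
    exact absurd hpr (lt_of_descents hfirst hpq).asymm
  exact hw (simple i p) (simple i q) (simple i r) ((simple_lt_simple_iff h1 (hne hpq)).2 hpq)
    ((simple_lt_simple_iff h2 (hne hqr)).2 hqr) hpr hrq

theorem code_posSucc_eq (hw : Avoids132 w) (hi : w (pos i) < w (posSucc i)) :
    code w (posSucc i) = code w (pos i) := by
  rw [code, code]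
  congr 1
  ext q
  simp only [Finset.mem_filter, Finset.mem_univ, true_and]
  constructor
  · rintro ⟨h1, h2⟩
    refine ⟨(pos_lt_posSucc i).trans h1, ?_⟩
    by_contra h3
    have h4 : w (pos i) < w q := lt_of_le_of_ne (not_lt.1 h3) fun e =>
      ((pos_lt_posSucc i).trans h1).ne (w.injective e)
    exact hw _ _ _ (pos_lt_posSucc i) h1 h4 h2
  · rintro ⟨h1, h2⟩
    refine ⟨lt_of_le_of_ne (show posSucc i ≤ q from h1) fun e => ?_, h2.trans hi⟩
    rw [← e] at h2
    exact absurd h2 hi.asymm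

theorem code_mul_simple_pos (hi : w (pos i) < w (posSucc i)) :
    code (w * simple i) (pos i) = code w (posSucc i) + 1 := by
  have h : (Finset.univ.filter fun q => pos i < q ∧ (w * simple i) q < (w * simple i) (pos i)) =
      insert (posSucc i) (Finset.univ.filter fun q => posSucc i < q ∧ w q < w (posSucc i)) := by
    ext q
    simp only [Finset.mem_filter, Finset.mem_univ, true_and, Finset.mem_insert,
      Equiv.Perm.mul_apply, simple_pos]
    by_cases hq : q = posSucc i
    · simp [hq, simple_posSucc, pos_lt_posSucc, hi]
    · constructor
      · rintro ⟨h1, h2⟩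
        rw [simple_of_ne h1.ne' hq] at h2
        exact Or.inr ⟨lt_of_le_of_ne (show posSucc i ≤ q from h1) (Ne.symm hq), h2⟩
      · rintro (h1 | ⟨h1, h2⟩)
        · exact absurd h1 hq
        · have h3 := (pos_lt_posSucc i).trans h1
          rw [simple_of_ne h3.ne' hq]
          exact ⟨h3, h2⟩
  rw [code, h, Finset.card_insert_of_notMem (by simp), code]

theorem code_mul_simple_posSucc (hi : w (pos i) < w (posSucc i)) :
    code (w * simple i) (posSucc i) = code w (pos i) := by
  rw [code, code]
  congr 1
  ext q
  simp only [Finset.mem_filter, Finset.mem_univ, true_and, Equiv.Perm.mul_apply, simple_posSucc]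
  constructor
  · rintro ⟨h1, h2⟩
    have h3 := (pos_lt_posSucc i).trans h1
    rw [simple_of_ne h3.ne' h1.ne'] at h2
    exact ⟨h3, h2⟩
  · rintro ⟨h1, h2⟩
    have h3 : posSucc i < q := lt_of_le_of_ne (show posSucc i ≤ q from h1) fun e => by
      rw [← e] at h2
      exact absurd h2 hi.asymm
    rw [simple_of_ne h1.ne' h3.ne']
    exact ⟨h3, h2⟩

theorem code_mul_simple_of_ne {k : Fin n} (h1 : k ≠ pos i) (h2 : k ≠ posSucc i) :
    code (w * simple i) k = code w k := by
  refine Finset.card_equiv (simple i) fun q => ?_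
  have h3 := simple_lt_simple_iff (j := i) (a := k) (b := q) (fun h => h1 h.1) (fun h => h2 h.1)
  rw [simple_of_ne h1 h2] at h3
  rw [Finset.mem_filter, Finset.mem_filter, h3, Equiv.Perm.mul_apply, Equiv.Perm.mul_apply,
    simple_of_ne h1 h2]
  simp only [Finset.mem_univ]

end FirstAscent

theorem grothendieck_eq_dividedDiffBar {w : Equiv.Perm (Fin n)} {i : Fin (n - 1)}
    (hi : w (pos i) < w (posSucc i)) :
    grothendieck w = dividedDiffBar i (grothendieck (w * simple i)) := by
  rw [(isRecursiveFamily_grothendieck n).descent, mul_simple_simple]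
  rwa [Equiv.Perm.mul_apply, Equiv.Perm.mul_apply, simple_pos, simple_posSucc]

/-- The Grothendieck polynomial of a dominant permutation is a monomial. -/
theorem grothendieck_of_avoids132 {w : Equiv.Perm (Fin n)} (hw : Avoids132 w) :
    grothendieck w = ∏ k, X k ^ code w k := by
  induction hN : weight w using Nat.strong_induction_on generalizing w with
  | _ N ih =>
  by_cases hex : ∃ i : Fin (n - 1), w (pos i) < w (posSucc i)
  · obtain ⟨i, hi, hfirst⟩ := WellFounded.has_min (wellFounded_lt (α := Fin (n - 1)))
      {i | w (pos i) < w (posSucc i)} hex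
    have hi : w (pos i) < w (posSucc i) := hi
    have h1 := ih _ (hN ▸ weight_lt w i hi)
      (avoids132_mul_simple hw (fun j hj h => hfirst j h hj) hi) rfl
    have hsplit : ∀ f : Fin n → MvPolynomial (Fin n) ℤ, ∏ k, f k =
        f (pos i) * (f (posSucc i) * ∏ k ∈ (Finset.univ.erase (pos i)).erase (posSucc i), f k) := by
      intro f
      rw [Finset.mul_prod_erase _ _ (Finset.mem_erase.2 ⟨(pos_ne_posSucc i).symm,
        Finset.mem_univ _⟩), Finset.mul_prod_erase _ _ (Finset.mem_univ _)]
    have hne : ∀ k ∈ (Finset.univ.erase (pos i)).erase (posSucc i), k ≠ pos i ∧ k ≠ posSucc i :=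
      fun k hk => ⟨Finset.ne_of_mem_erase (Finset.mem_of_mem_erase hk), Finset.ne_of_mem_erase hk⟩
    have hrest : ∏ k ∈ (Finset.univ.erase (pos i)).erase (posSucc i),
        (X k : MvPolynomial (Fin n) ℤ) ^ code (w * simple i) k =
        ∏ k ∈ (Finset.univ.erase (pos i)).erase (posSucc i), X k ^ code w k :=
      Finset.prod_congr rfl fun k hk => by rw [code_mul_simple_of_ne (hne k hk).1 (hne k hk).2]
    have hren : rename (simple i) (∏ k ∈ (Finset.univ.erase (pos i)).erase (posSucc i),
        (X k : MvPolynomial (Fin n) ℤ) ^ code w k) =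
        ∏ k ∈ (Finset.univ.erase (pos i)).erase (posSucc i), X k ^ code w k := by
      rw [map_prod]
      refine Finset.prod_congr rfl fun k hk => ?_
      rw [map_pow, rename_X, simple_of_ne (hne k hk).1 (hne k hk).2]
    rw [hsplit, hrest, code_mul_simple_pos hi, code_mul_simple_posSucc hi,
      code_posSucc_eq hw hi] at h1
    apply mul_left_cancel₀ (X_sub_X_ne_zero (R := ℤ) (pos_ne_posSucc i))
    rw [grothendieck_eq_dividedDiffBar hi, mul_dividedDiffBar, h1, hsplit, map_mul, map_mul, hren,
      map_pow, map_pow, rename_X, rename_X, simple_pos, simple_posSucc, code_posSucc_eq hw hi]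
    ring
  · have hrev := eq_rev_of_no_ascent w (by simpa using hex)
    rw [hrev, (isRecursiveFamily_grothendieck n).initial, prod_varSeq]
    exact Finset.prod_congr rfl fun k _ => by rw [code_revPerm]

theorem totalDegree_grothendieck_of_avoids132 {w : Equiv.Perm (Fin n)} (hw : Avoids132 w) :
    (grothendieck w).totalDegree ≤ raj w := by
  rw [grothendieck_of_avoids132 hw]
  refine (totalDegree_finsetProd _ _).trans (Finset.sum_le_sum fun k _ => ?_)
  rw [totalDegree_X_pow]
  exact code_le_rajCode w k

end Dominant

/-! ### The degree of a Grothendieck polynomial -/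

section Degree

open MvPolynomial

variable {n : ℕ}

theorem totalDegree_dividedDiffBar_le (i : Fin (n - 1)) (f : MvPolynomial (Fin n) ℤ) :
    (dividedDiffBar i f).totalDegree ≤ f.totalDegree := by
  rcases eq_or_ne (dividedDiffBar i f) 0 with h0 | h0
  · rw [h0, totalDegree_zero]
    exact Nat.zero_le _
  have hne := X_sub_X_ne_zero (R := ℤ) (pos_ne_posSucc i)
  have h1 := congrArg totalDegree (mul_dividedDiffBar i f)
  rw [totalDegree_mul_of_isDomain hne h0] at h1
  have h2 : 1 ≤ (X (pos i) - X (posSucc i) : MvPolynomial (Fin n) ℤ).totalDegree := by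
    have : Finsupp.single (pos i) 1 ∈ (X (pos i) - X (posSucc i) : MvPolynomial (Fin n) ℤ).support := by
      rw [mem_support_iff, coeff_sub, coeff_X, coeff_X, if_pos rfl, if_neg]
      · norm_num
      · exact fun e => pos_ne_posSucc i (Finsupp.single_left_injective one_ne_zero e).symm
    simpa using le_totalDegree this
  have h3 : ∀ a : Fin n, (1 - X a : MvPolynomial (Fin n) ℤ).totalDegree ≤ 1 := fun a =>
    (totalDegree_sub _ _).trans (by rw [totalDegree_one, totalDegree_X]; simp)
  have h4 : ((1 - X (posSucc i)) * f).totalDegree ≤ 1 + f.totalDegree :=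
    (totalDegree_mul _ _).trans (Nat.add_le_add_right (h3 _) _)
  have h5 : ((1 - X (pos i)) * rename (simple i) f).totalDegree ≤ 1 + f.totalDegree :=
    (totalDegree_mul _ _).trans (Nat.add_le_add (h3 _) (totalDegree_rename_le _ _))
  have h6 := totalDegree_sub ((1 - X (posSucc i)) * f) ((1 - X (pos i)) * rename (simple i) f)
  have h7 := max_le h4 h5
  omega

theorem weight_inv (w : Equiv.Perm (Fin n)) : weight w⁻¹ = weight w := by
  rw [weight, weight, ← Equiv.sum_comp w]
  exact Finset.sum_congr rfl fun k _ => by rw [inv_apply_apply, mul_comm]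

theorem totalDegree_le_raj (w : Equiv.Perm (Fin n)) : (grothendieck w).totalDegree ≤ raj w := by
  induction hN : weight w using Nat.strong_induction_on generalizing w with
  | _ N ih =>
  have key : ∀ u : Equiv.Perm (Fin n), weight u = N → HasRedundantAscent u →
      (grothendieck u).totalDegree ≤ raj u := by
    rintro u hu ⟨i, hi, x, hx, hwx, hlev⟩
    rw [grothendieck_eq_dividedDiffBar hi]
    exact (totalDegree_dividedDiffBar_le i _).trans
      ((ih _ (hu ▸ weight_lt u i hi) _ rfl).trans (raj_mul_simple_le hi hx hwx hlev))
  by_cases hw : Avoids132 w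
  · exact totalDegree_grothendieck_of_avoids132 hw
  · rcases hasRedundantAscent_of_not_avoids132 hw with h | h
    · exact key w hN h
    · rw [← totalDegree_grothendieck_inv, ← raj_inv]
      exact key w⁻¹ ((weight_inv w).trans hN) h

theorem totalDegree_grothendieck_eq_raj (w : Equiv.Perm (Fin n)) :
    (grothendieck w).totalDegree = raj w :=
  le_antisymm (totalDegree_le_raj w) (raj_le_totalDegree w)

theorem homogeneousComponent_totalDegree_ne_zero {σ R : Type*} [CommSemiring R]
    {p : MvPolynomial σ R} (hp : p ≠ 0) : homogeneousComponent p.totalDegree p ≠ 0 := by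
  obtain ⟨m, hm, e⟩ := Finset.exists_mem_eq_sup p.support (support_nonempty.2 hp)
    fun m => m.sum fun _ e => e
  have e' : m.degree = p.totalDegree := e.symm
  intro h
  have h1 := congrArg (coeff m) h
  rw [coeff_homogeneousComponent, if_pos e', coeff_zero] at h1
  exact mem_support_iff.1 hm h1

theorem castelnuovoMumford_ne_zero (w : Equiv.Perm (Fin n)) : castelnuovoMumford w ≠ 0 :=
  mul_ne_zero (C_ne_zero.2 (Units.ne_zero _))
    (homogeneousComponent_totalDegree_ne_zero (grothendieck_ne_zero w))

theorem totalDegree_castelnuovoMumford (w : Equiv.Perm (Fin n)) :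
    (castelnuovoMumford w).totalDegree = raj w := by
  have h := (isHomogeneous_C (Fin n) ((((-1 : ℤˣ) ^ (((grothendieck w).totalDegree : ℤ) - inv w) :
    ℤˣ) : ℤ))).mul (homogeneousComponent_isHomogeneous (grothendieck w).totalDegree (grothendieck w))
  rw [zero_add, totalDegree_grothendieck_eq_raj] at h
  rw [← totalDegree_grothendieck_eq_raj] at h ⊢
  exact h.totalDegree (castelnuovoMumford_ne_zero w)

end Degree

end Rajchgot

theorem theorem1p4 (n : ℕ) (w : Equiv.Perm (Fin n)) :
    -- `raj(w)` is the maximum of `maj(v)` over `v ≤_R w`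
    IsGreatest {m : ℕ | ∃ v : Equiv.Perm (Fin n), Rajchgot.RightWeakLE v w ∧ m = Rajchgot.maj v}
      (Rajchgot.raj w) ∧
    -- `raj(w)` is the maximum of `maj(u⁻¹)` over `u ≤_L w`
    IsGreatest {m : ℕ | ∃ u : Equiv.Perm (Fin n), Rajchgot.LeftWeakLE u w ∧ m = Rajchgot.maj u⁻¹}
      (Rajchgot.raj w) ∧
    -- `raj(w)` is the degree of the (nonzero) Castelnuovo–Mumford polynomial
    (Rajchgot.castelnuovoMumford w ≠ 0 ∧
      (Rajchgot.castelnuovoMumford w).totalDegree = Rajchgot.raj w) ∧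
    -- the first maximum is attained at the fireworks image
    (Rajchgot.RightWeakLE (Rajchgot.fireworks w) w ∧
      Rajchgot.maj (Rajchgot.fireworks w) = Rajchgot.raj w) ∧
    -- the second maximum is attained at the inverse fireworks image
    (Rajchgot.LeftWeakLE (Rajchgot.invFireworks w) w ∧
      Rajchgot.maj (Rajchgot.invFireworks w)⁻¹ = Rajchgot.raj w) := by
  have h2 : Rajchgot.LeftWeakLE (Rajchgot.invFireworks w) w ∧
      Rajchgot.maj (Rajchgot.invFireworks w)⁻¹ = Rajchgot.raj w := by
    rw [Rajchgot.leftWeakLE_iff_inv, Rajchgot.invFireworks, inv_inv, Rajchgot.maj_fireworks,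
      Rajchgot.raj_inv]
    exact ⟨Rajchgot.fireworks_rightWeakLE w⁻¹, rfl⟩
  refine ⟨⟨⟨_, Rajchgot.fireworks_rightWeakLE w, (Rajchgot.maj_fireworks w).symm⟩, ?_⟩,
    ⟨⟨_, h2.1, h2.2.symm⟩, ?_⟩,
    ⟨Rajchgot.castelnuovoMumford_ne_zero w, Rajchgot.totalDegree_castelnuovoMumford w⟩,
    ⟨Rajchgot.fireworks_rightWeakLE w, Rajchgot.maj_fireworks w⟩, h2⟩
  · rintro m ⟨v, hv, rfl⟩
    exact (Rajchgot.maj_le_raj v).trans (Rajchgot.raj_mono hv)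
  · rintro m ⟨u, hu, rfl⟩
    rw [← Rajchgot.raj_inv w]
    exact (Rajchgot.maj_le_raj u⁻¹).trans
      (Rajchgot.raj_mono ((Rajchgot.leftWeakLE_iff_inv u w).1 hu))
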